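/- Let $D$ be a unique factorization domain of characteristic zero, $R=D[q,q^{-1}]$ with $q$ transcendental over $D$, and $n\ge 0$; write $\bm x=(x_1,\dots,x_n)$ and $\bm x^{\bm a}=x_1^{a_1}\cdots x_n^{a_n}$. **Definitions.** The *content* of a polynomial is the gcd of its coefficients; dividing by it gives the *primitive part*. Subscripts ($\operatorname{cont}_{x_i},\operatorname{prim}_{x_i}$) mean that the polynomial is viewed as a polynomial in the indicated variables over the polynomial ring in the others. Contents are determined up to units. A polynomial is *primitive* if its content is $1$; $P\in R[y]$ is *$q$-primitive* if it is primitive and $P(0)\ne0$. Call $\bm\lambda\in\mathbb Z^n$ *normalized* if $\gcd(\lambda_1,\dots,\lambda_n)=1$ and its rightmost nonzero coordinate is positive. The *direction vector* of a nondegenerate segment $[\bm u,\bm v]$ is the normalized $\bm\lambda\in\mathbb Z^n$ with $\bm u-\bm v\in\mathbb R\bm\lambda$. $\operatorname{Newt}(f)\subset\mathbb R^n$ is the convex hull of the set $\operatorname{supp}(f)$ of exponent vectors of $f$; its edges are its one-dimensional faces (a polytope that is a segment is its own edge). An irreducible $p\in R[\bm x]$ is *$q$-integer linear* if $p=\bm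 x^{\bm a}P(\bm x^{\bm\lambda})$ for some $P\in R[y]$ and $\bm a,\bm\lambda\in\mathbb Z^n$. An expression $$p=c\,\bm x^{\bm\alpha}P_0\prod_{i=1}^mP_i(\bm x^{\bm\lambda_i}),\qquad c\in R,\ \bm\alpha\in\mathbb N^n,\ P_0\in R[\bm x],\ P_i\in R[y],\ \bm\lambda_i\in\mathbb Z^n,$$ is the *$q$-integer linear decomposition* of $p$ if (1) $P_0$ is primitive and none of its irreducible factors of positive total degree is $q$-integer linear; (2) each $P_i$ ($i\ge1$) is $q$-primitive of positive degree; (3) each $\bm\lambda_i$ is normalized; (4) the $\bm\lambda_i$ are pairwise distinct. **Algorithm MultivariateQILD$_1$**, on input $p\in R[\bm x]$. 1. If $p\in R$, return $c=p$ (with $\bm\alpha=\bm 0$, $P_0=1$, $m=0$). 2. Set $c=\operatorname{cont}(p)$, $f=\operatorname{prim}(p)$. If $\operatorname{supp}(f)=\{\bm\alpha\}$, replace $c$ by $cf/\bm x^{\bm\alpha}$ and return $c\,\bm x^{\bm\alpha}$. 3. If $n=1$, let $\alpha_1$ be the lowest degree of $f$, $P_1(y)=f(y)/y^{\alpha_1}$,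 and return $c\,x_1^{\alpha_1}P_1(x_1)$. 4. Set $\bm\alpha=\bm0$, $P_0=1$, $m=0$. For $i=1,\dots,n$: set $g=\operatorname{cont}_{x_i}(f)$ and replace $f$ by $\operatorname{prim}_{x_i}(f)$; if $g\neq1$, call the algorithm recursively on $g$, a polynomial in the $n-1$ variables other than $x_i$, and merge the result into the current data: multiply $c$ and $P_0$ by the returned $\tilde c$ and $\tilde P_0$, and, after inserting a $0$ in the $i$-th coordinate of the returned exponent vector and types, add the former to $\bm\alpha$ and append the types with their univariate polynomials. 5. If $\deg f=0$, replace $c$ by $cf$ and return $c\,\bm x^{\bm\alpha}P_0\prod_{i}P_i(\bm x^{\bm\lambda_i})$. 6. Let $\Lambda$ be the multiset of direction vectors, having no zero coordinates, of the edges of $\operatorname{Newt}(f)$. 7. If $\Lambda$ has more than one element, fix $\bm v\in\operatorname{supp}(f)$ and replace $\Lambda$ by the set of those elements that occur at least twice in $\Lambda$ and that are direction vectors of segments joining $\bm v$ to other points of $\operatorname{supp}(f)$. 8. For each $\bm\lambda\in\Lambda$: let $P^*(y)\in R[y]$ be the content, with respect to $x_1,\dots,x_{n-1}$, of the numerator of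 $f(x_1^{\lambda_n},\dots,x_{n-1}^{\lambda_n},\,y\,x_1^{-\lambda_1}\cdots x_{n-1}^{-\lambda_{n-1}})$. If $\deg P^*>0$, increase $m$ by $1$, set $\bm\lambda_m=\bm\lambda$ and $P_m(y)=P^*(y^{1/\lambda_n})$, write $P_m(\bm x^{\bm\lambda})=f^*/\bm x^{\bm\beta}$ in lowest terms, replace $f$ by $f/f^*$ and add $\bm\beta$ to $\bm\alpha$. 9. If $\deg f>0$, replace $P_0$ by $P_0f$; otherwise replace $c$ by $cf$. 10. Return $c\,\bm x^{\bm\alpha}P_0\prod_{i=1}^mP_i(\bm x^{\bm\lambda_i})$. **Theorem.** For every $p\in R[\bm x]$, the algorithm MultivariateQILD$_1$ terminates on input $p$ and correctly computes the $q$-integer linear decomposition of $p$. That is, whatever choices are made (of the contents up to units, of the points $\bm v$, of the order in which the elements of $\Lambda$ are treated), every run is finite and can always be continued until the algorithm returns, and the returned expression is the $q$-integer linear decomposition of $p$. -/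

import Mathlib

namespace QILD

noncomputable section

/-! ## Greatest common divisors, contents, primitivity -/

/-- `g` is a greatest common divisor of the elements of `S` (unique up to units in a domain). -/
def IsGCDOf {A : Type*} [CommRing A] (S : Set A) (g : A) : Prop :=
  (∀ a ∈ S, g ∣ a) ∧ ∀ d : A, (∀ a ∈ S, d ∣ a) → d ∣ g

/-- `c` is a content over `A` of the polynomial `p` in all its variables: a greatest common divisor
of the coefficients of `p`. -/
def IsContent {A : Type*} [CommRing A] {n : ℕ} (p : MvPolynomial (Fin n) A) (c : A) : Prop :=
  IsGCDOf (Set.range fun m => p.coeff m) c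

/-- A polynomial is primitive over `A` if its content is `1`. -/
def IsPrimitive {A : Type*} [CommRing A] {n : ℕ} (p : MvPolynomial (Fin n) A) : Prop :=
  IsContent p 1

/-- A univariate polynomial is `q`-primitive if it is primitive and its constant term is nonzero. -/
def IsQPrimitive {A : Type*} [CommRing A] (P : Polynomial A) : Prop :=
  P.IsPrimitive ∧ P.coeff 0 ≠ 0

/-- View a polynomial in `x_0, …, x_n` as a univariate polynomial in `x_i` whose coefficients are
polynomials in the other variables (renumbered in increasing order). -/
def asPolyIn {A : Type*} [CommRing A] {n : ℕ} (i : Fin (n + 1)) :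
    MvPolynomial (Fin (n + 1)) A →ₐ[A] Polynomial (MvPolynomial (Fin n) A) :=
  MvPolynomial.aeval
    (i.insertNth (α := fun _ => Polynomial (MvPolynomial (Fin n) A))
      Polynomial.X (fun j => Polynomial.C (MvPolynomial.X j)))

/-- `g`, a polynomial in the variables other than `x_i`, is a content of `f` with respect to `x_i`:
a greatest common divisor of the coefficients of `f` viewed as a polynomial in `x_i` alone. -/
def IsContentAt {A : Type*} [CommRing A] {n : ℕ} (i : Fin (n + 1))
    (f : MvPolynomial (Fin (n + 1)) A) (g : MvPolynomial (Fin n) A) : Prop :=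
  IsGCDOf (Set.range fun k => (asPolyIn i f).coeff k) g

/-- A polynomial in the variables other than `x_i`, regarded as a polynomial in all variables. -/
def embedAt {A : Type*} [CommRing A] {n : ℕ} (i : Fin (n + 1)) :
    MvPolynomial (Fin n) A →ₐ[A] MvPolynomial (Fin (n + 1)) A :=
  MvPolynomial.rename i.succAbove

/-! ## Laurent polynomials in `n` variables -/

/-- The Laurent polynomial ring `A[x_1, x_1⁻¹, …, x_n, x_n⁻¹]`. -/
abbrev Laurent (A : Type*) [CommRing A] (n : ℕ) : Type _ := AddMonoidAlgebra A (Fin n → ℤ)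

/-- The Laurent monomial `x^a`, `a ∈ ℤⁿ`. -/
def mono (A : Type*) [CommRing A] {n : ℕ} (a : Fin n → ℤ) : Laurent A n :=
  AddMonoidAlgebra.single a 1

/-- The inclusion of polynomials into Laurent polynomials. -/
def toLaurent {A : Type*} [CommRing A] {n : ℕ} : MvPolynomial (Fin n) A →ₐ[A] Laurent A n :=
  MvPolynomial.aeval fun i => mono A (Pi.single i 1)

/-- The Laurent polynomial `P(x^l)`. -/
def substMono {A : Type*} [CommRing A] {n : ℕ} (P : Polynomial A) (l : Fin n → ℤ) : Laurent A n :=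
  Polynomial.aeval (mono A l) P

/-- `w = h / x^b` in lowest terms, i.e. `h` is the numerator of the Laurent polynomial `w`
and the monomial `x^b` is its denominator. -/
def IsNumDen {A : Type*} [CommRing A] {n : ℕ} (w : Laurent A n)
    (h : MvPolynomial (Fin n) A) (b : Fin n → ℕ) : Prop :=
  toLaurent h = mono A (fun i => (b i : ℤ)) * w ∧
    ∀ i, b i = 0 ∨ ¬ (MvPolynomial.X i ∣ h)

/-! ## The `q`-integer linear decomposition -/

/-- An integer vector whose coordinates have greatest common divisor `1` and whose rightmost nonzero
coordinate is positive. -/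
def IsNormalizedVec {n : ℕ} (l : Fin n → ℤ) : Prop :=
  Finset.univ.gcd l = 1 ∧ ∃ k, 0 < l k ∧ ∀ j, k < j → l j = 0

/-- `p = x^a P(x^l)` for a univariate polynomial `P` and integer vectors `a` and `l`.  For an
irreducible polynomial `p` this says that `p` is `q`-integer linear. -/
def IsQIntegerLinear {A : Type*} [CommRing A] {n : ℕ} (p : MvPolynomial (Fin n) A) : Prop :=
  ∃ (P : Polynomial A) (a l : Fin n → ℤ), toLaurent p = mono A a * substMono P l

/-- The data `c`, `α`, `P_0` and `(λ_1, P_1), …, (λ_m, P_m)` of an expression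
`c x^α P_0 ∏ P_i(x^{λ_i})`. -/
structure Decomp (A : Type*) [CommRing A] (n : ℕ) where
  c : A
  α : Fin n → ℕ
  P₀ : MvPolynomial (Fin n) A
  factors : List ((Fin n → ℤ) × Polynomial A)

/-- The Laurent polynomial `c x^α P_0 ∏ P_i(x^{λ_i})`. -/
def Decomp.value {A : Type*} [CommRing A] {n : ℕ} (d : Decomp A n) : Laurent A n :=
  d.c • (mono A (fun i => (d.α i : ℤ)) * toLaurent d.P₀ *
    (d.factors.map fun t => substMono t.2 t.1).prod)

/-- `d` is the `q`-integer linear decomposition of `p`. -/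
structure IsQILD {A : Type*} [CommRing A] {n : ℕ} (p : MvPolynomial (Fin n) A)
    (d : Decomp A n) : Prop where
  eq_value : toLaurent p = d.value
  primitive_P₀ : IsPrimitive d.P₀
  not_qil_P₀ : ∀ h : MvPolynomial (Fin n) A,
    Irreducible h → h ∣ d.P₀ → 0 < h.totalDegree → ¬ IsQIntegerLinear h
  qprimitive : ∀ t ∈ d.factors, IsQPrimitive t.2 ∧ 0 < t.2.natDegree
  normalized : ∀ t ∈ d.factors, IsNormalizedVec t.1
  distinct : (d.factors.map Prod.fst).Nodup

/-! ## Newton polytopes and direction vectors -/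

/-- An exponent vector as a point of `ℝⁿ`. -/
def expPoint {n : ℕ} (m : Fin n →₀ ℕ) : Fin n → ℝ := fun i => (m i : ℝ)

/-- The Newton polytope: the convex hull of the support. -/
def newt {A : Type*} [CommRing A] {n : ℕ} (p : MvPolynomial (Fin n) A) : Set (Fin n → ℝ) :=
  convexHull ℝ (expPoint '' (p.support : Set (Fin n →₀ ℕ)))

/-- `l` is the direction vector of the segment `[u, v]`. -/
def IsDirection {n : ℕ} (u v : Fin n → ℝ) (l : Fin n → ℤ) : Prop :=
  u ≠ v ∧ IsNormalizedVec l ∧ ∃ t : ℝ, u - v = t • (fun i => (l i : ℝ))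

/-- The set of edges of the Newton polytope of `p` with direction vector `l`.  An edge is a face
that is a nondegenerate segment.  A nonempty face is the set of points at which some linear
functional attains its maximum over the polytope; the zero functional gives the improper face,
so a Newton polytope that is itself a segment is its own edge. -/
def edgesOfDirection {A : Type*} [CommRing A] {n : ℕ} (p : MvPolynomial (Fin n) A)
    (l : Fin n → ℤ) : Set (Set (Fin n → ℝ)) :=
  {F | IsExposed ℝ (newt p) F ∧ ∃ u v, F = segment ℝ u v ∧ IsDirection u v l}

/-- `Λ` is the multiset of direction vectors of edges of the Newton polytope of `p` that have no
zero coordinates: each such vector occurs as often as there are edges with that direction. -/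
def IsEdgeDirections {A : Type*} [CommRing A] {n : ℕ} (p : MvPolynomial (Fin n) A)
    (Λ : Multiset (Fin n → ℤ)) : Prop :=
  ∀ l : Fin n → ℤ,
    ((∀ i, l i ≠ 0) → (Λ.count l : ℕ∞) = (edgesOfDirection p l).encard) ∧
    ((∃ i, l i = 0) → Λ.count l = 0)

/-- The set of direction vectors without zero coordinates of segments that connect the support
point `v` with another support point of `p`. -/
def supportDirections {A : Type*} [CommRing A] {n : ℕ} (p : MvPolynomial (Fin n) A)
    (v : Fin n →₀ ℕ) : Set (Fin n → ℤ) :=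
  {l | (∀ i, l i ≠ 0) ∧ ∃ w ∈ p.support, w ≠ v ∧ IsDirection (expPoint v) (expPoint w) l}

/-! ## The algorithm -/

/-- The Laurent polynomial
`f(x_1^{λ_n}, …, x_{n-1}^{λ_n}, y x_1^{-λ_1} ⋯ x_{n-1}^{-λ_{n-1}})` in `x_1, …, x_{n-1}`
over `A[y]`; here the variables of `f` are indexed by `Fin (n + 1)`. -/
def typeSubst {A : Type*} [CommRing A] {n : ℕ} (l : Fin (n + 1) → ℤ)
    (f : MvPolynomial (Fin (n + 1)) A) : Laurent (Polynomial A) n :=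
  MvPolynomial.aeval
    (Fin.snoc (α := fun _ => Laurent (Polynomial A) n)
      (fun i : Fin n => mono (Polynomial A) (Pi.single i (l (Fin.last n))))
      ((Polynomial.X : Polynomial A) • mono (Polynomial A) (fun i : Fin n => - l i.castSucc))) f

/-- `P` is the content with respect to `x_1, …, x_{n-1}` of the numerator of the Laurent polynomial
`typeSubst l f`. -/
def IsTypeContent {A : Type*} [CommRing A] {n : ℕ} (l : Fin (n + 1) → ℤ)
    (f : MvPolynomial (Fin (n + 1)) A) (P : Polynomial A) : Prop :=
  ∃ (h : MvPolynomial (Fin n) (Polynomial A)) (b : Fin n → ℕ),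
    IsNumDen (typeSubst l f) h b ∧ IsContent h P

/-- Merge into the data `d` collected so far the decomposition `e` of a polynomial in the variables
other than `x_i`. -/
def Decomp.merge {A : Type*} [CommRing A] {n : ℕ} (i : Fin (n + 1))
    (d : Decomp A (n + 1)) (e : Decomp A n) : Decomp A (n + 1) where
  c := d.c * e.c
  α := d.α + i.insertNth (α := fun _ => ℕ) 0 e.α
  P₀ := d.P₀ * embedAt i e.P₀
  factors := d.factors ++
    e.factors.map fun t => (i.insertNth (α := fun _ => ℤ) 0 t.1, t.2)

/-- The points of control of one invocation on a polynomial in `n` variables, with the current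
values of the program variables.  The record `d` holds `c`, `α`, `P_0`, `m`, the `λ_j` and `P_j`. -/
inductive State (A : Type*) [CommRing A] (n : ℕ)
  /-- the beginning, with input `p` -/
  | start (p : MvPolynomial (Fin n) A)
  /-- the content `c` has been split off, `f` is the primitive part and is not a monomial -/
  | primPart (c : A) (f : MvPolynomial (Fin n) A)
  /-- the loop over the variables, the next one having index `k` -/
  | varLoop (k : ℕ) (d : Decomp A n) (f : MvPolynomial (Fin n) A)
  /-- the loop over the variables is over -/
  | edges (d : Decomp A n) (f : MvPolynomial (Fin n) A)
  /-- the edge directions have been computed -/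
  | select (Λ : Multiset (Fin n → ℤ)) (d : Decomp A n) (f : MvPolynomial (Fin n) A)
  /-- the loop over the candidates, those in `L` remaining -/
  | typeLoop (L : Finset (Fin n → ℤ)) (d : Decomp A n) (f : MvPolynomial (Fin n) A)
  /-- the invocation returns `d` -/
  | done (d : Decomp A n)

/-- The steps of one invocation that are not recursive calls.  Where the algorithm leaves a choice
(a content is determined up to units, a support point is fixed arbitrarily, the candidates are
taken in some order), every choice is allowed. -/
inductive LocalStep {A : Type*} [CommRing A] : {n : ℕ} → State A n → State A n → Prop
  /-- a constant input is returned -/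
  | constant {n : ℕ} {p : MvPolynomial (Fin n) A} {a : A} (hp : p = MvPolynomial.C a) :
      LocalStep (.start p) (.done ⟨a, 0, 1, []⟩)
  /-- split off the content; the primitive part is a monomial up to a constant -/
  | monomial {n : ℕ} {p f : MvPolynomial (Fin n) A} {c : A} {a : Fin n →₀ ℕ}
      (hp : ∀ r, p ≠ MvPolynomial.C r) (hc : IsContent p c) (hf : p = MvPolynomial.C c * f)
      (ha : f.support = {a}) :
      LocalStep (.start p) (.done ⟨c * f.coeff a, a, 1, []⟩)
  /-- split off the content; the primitive part has at least two monomials -/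
  | content {n : ℕ} {p f : MvPolynomial (Fin n) A} {c : A}
      (hp : ∀ r, p ≠ MvPolynomial.C r) (hc : IsContent p c) (hf : p = MvPolynomial.C c * f)
      (ha : ∀ a, f.support ≠ {a}) :
      LocalStep (.start p) (.primPart c f)
  /-- one variable: `f = x^a P(x)` with `a` the lowest degree of `f` -/
  | univariate {c : A} {f : MvPolynomial (Fin 1) A} {a : ℕ} {P : Polynomial A}
      (ha : IsLeast {k | ∃ m ∈ f.support, m 0 = k} a)
      (hP : f = MvPolynomial.X 0 ^ a * Polynomial.aeval (MvPolynomial.X 0) P) :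
      LocalStep (.primPart c f) (.done ⟨c, fun _ => a, 1, [(fun _ => 1, P)]⟩)
  /-- several variables: start the loop over the variables -/
  | multivariate {n : ℕ} {c : A} {f : MvPolynomial (Fin n) A} (hn : n ≠ 1) :
      LocalStep (.primPart c f) (.varLoop 0 ⟨c, 0, 1, []⟩ f)
  /-- the content with respect to `x_k` is `1`, so that `f` is its own primitive part -/
  | noContent {n k : ℕ} {d : Decomp A (n + 1)} {f : MvPolynomial (Fin (n + 1)) A}
      (hk : k < n + 1) (hg : IsContentAt ⟨k, hk⟩ f 1) :
      LocalStep (.varLoop k d f) (.varLoop (k + 1) d f)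
  /-- all variables have been treated -/
  | varsDone {n k : ℕ} {d : Decomp A n} {f : MvPolynomial (Fin n) A} (hk : n ≤ k) :
      LocalStep (.varLoop k d f) (.edges d f)
  /-- nothing but a constant is left -/
  | constantRest {n : ℕ} {d : Decomp A n} {f : MvPolynomial (Fin n) A} (hf : f.totalDegree = 0) :
      LocalStep (.edges d f) (.done { d with c := d.c * f.coeff 0 })
  /-- compute the multiset of edge directions -/
  | edgeDirections {n : ℕ} {d : Decomp A n} {f : MvPolynomial (Fin n) A}
      {Λ : Multiset (Fin n → ℤ)} (hf : 0 < f.totalDegree) (hΛ : IsEdgeDirections f Λ) :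
      LocalStep (.edges d f) (.select Λ d f)
  /-- at most one edge direction: keep it -/
  | selectAll {n : ℕ} {d : Decomp A n} {f : MvPolynomial (Fin n) A} {Λ : Multiset (Fin n → ℤ)}
      (hΛ : Multiset.card Λ ≤ 1) :
      LocalStep (.select Λ d f) (.typeLoop Λ.toFinset d f)
  /-- several edge directions: keep those of multiplicity at least two that are directions from a
  fixed support point `v` to another support point -/
  | selectMultiple {n : ℕ} {d : Decomp A n} {f : MvPolynomial (Fin n) A}
      {Λ : Multiset (Fin n → ℤ)} {L : Finset (Fin n → ℤ)} {v : Fin n →₀ ℕ}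
      (hΛ : 1 < Multiset.card Λ) (hv : v ∈ f.support)
      (hL : ∀ l, l ∈ L ↔ 2 ≤ Λ.count l ∧ l ∈ supportDirections f v) :
      LocalStep (.select Λ d f) (.typeLoop L d f)
  /-- the candidate `l` has a content of degree zero in `y` -/
  | rejectType {n : ℕ} {d : Decomp A (n + 1)} {f : MvPolynomial (Fin (n + 1)) A}
      {L : Finset (Fin (n + 1) → ℤ)} {l : Fin (n + 1) → ℤ} {P : Polynomial A}
      (hl : l ∈ L) (hP : IsTypeContent l f P) (hdeg : P.natDegree = 0) :
      LocalStep (.typeLoop L d f) (.typeLoop (L.erase l) d f)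
  /-- the candidate `l` has a content `P(y) = Q(y^{l_n})` of positive degree in `y`: record the
  factor `Q(x^l) = h / x^b` and replace `f` by `f / h` -/
  | acceptType {n : ℕ} {d : Decomp A (n + 1)} {f f' h : MvPolynomial (Fin (n + 1)) A}
      {L : Finset (Fin (n + 1) → ℤ)} {l : Fin (n + 1) → ℤ} {P Q : Polynomial A}
      {b : Fin (n + 1) → ℕ}
      (hl : l ∈ L) (hP : IsTypeContent l f P) (hdeg : 0 < P.natDegree)
      (hQ : P = Polynomial.expand A (l (Fin.last n)).toNat Q)
      (hh : IsNumDen (substMono Q l) h b) (hf : f = f' * h) :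
      LocalStep (.typeLoop L d f)
        (.typeLoop (L.erase l) ⟨d.c, d.α + b, d.P₀, d.factors ++ [(l, Q)]⟩ f')
  /-- no candidate is left, and `f` is not constant -/
  | returnRest {n : ℕ} {d : Decomp A n} {f : MvPolynomial (Fin n) A} (hf : 0 < f.totalDegree) :
      LocalStep (.typeLoop ∅ d f) (.done { d with P₀ := d.P₀ * f })
  /-- no candidate is left, and `f` is constant -/
  | returnConstant {n : ℕ} {d : Decomp A n} {f : MvPolynomial (Fin n) A}
      (hf : f.totalDegree = 0) :
      LocalStep (.typeLoop ∅ d f) (.done { d with c := d.c * f.coeff 0 })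

/-- The stack of suspended invocations below an invocation in `n` variables, the outermost one being
in `N` variables.  A suspended invocation waits in the loop over its variables, at `x_i`, for the
decomposition of a content with respect to `x_i`; it remembers its data `d` and `f`. -/
inductive Stack (A : Type*) [CommRing A] (N : ℕ) : ℕ → Type _
  | nil : Stack A N N
  | push {n : ℕ} (i : Fin (n + 1)) (d : Decomp A (n + 1)) (f : MvPolynomial (Fin (n + 1)) A)
      (below : Stack A N (n + 1)) : Stack A N n

/-- A configuration of the algorithm: the state of the active invocation and the stack. -/
structure Config (A : Type*) [CommRing A] (N : ℕ) where
  {numVars : ℕ}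
  state : State A numVars
  stack : Stack A N numVars

/-- One step of the algorithm. -/
inductive Step {A : Type*} [CommRing A] {N : ℕ} : Config A N → Config A N → Prop
  /-- a step of the active invocation -/
  | inside {n : ℕ} {s s' : State A n} {st : Stack A N n} (h : LocalStep s s') :
      Step ⟨s, st⟩ ⟨s', st⟩
  /-- a recursive call on the content `g ≠ 1` with respect to `x_k`; `f'` is the primitive part -/
  | call {n k : ℕ} {d : Decomp A (n + 1)} {f f' : MvPolynomial (Fin (n + 1)) A}
      {g : MvPolynomial (Fin n) A} {st : Stack A N (n + 1)} (hk : k < n + 1)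
      (hg : IsContentAt ⟨k, hk⟩ f g) (hf : f = embedAt ⟨k, hk⟩ g * f') (h1 : g ≠ 1) :
      Step ⟨.varLoop k d f, st⟩ ⟨.start g, .push ⟨k, hk⟩ d f' st⟩
  /-- return from a recursive call -/
  | ret {n : ℕ} {e : Decomp A n} {i : Fin (n + 1)} {d : Decomp A (n + 1)}
      {f : MvPolynomial (Fin (n + 1)) A} {st : Stack A N (n + 1)} :
      Step ⟨.done e, .push i d f st⟩ ⟨.varLoop ((i : ℕ) + 1) (d.merge i e) f, st⟩

/-- The initial configuration on input `p`. -/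
def initial {A : Type*} [CommRing A] {N : ℕ} (p : MvPolynomial (Fin N) A) : Config A N :=
  ⟨.start p, .nil⟩

/-- The final configuration with output `d`. -/
def final {A : Type*} [CommRing A] {N : ℕ} (d : Decomp A N) : Config A N :=
  ⟨.done d, .nil⟩

end

end QILD

set_option linter.unusedSectionVars false

namespace QILD

noncomputable section

/-! ### Laurent monomials and the embedding of polynomials -/

section Laurent

variable {A : Type*} [CommRing A] {n : ℕ}

/-! Throughout a run the input equals the value of the collected data times the current `f`, and `f`
stays primitive. The content of the theorem is that the accepted types account for all `q`-integer
linear factors, that step 8 is always executable, and that the types are distinct.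

In at least two variables, `f` leaves the variable loop with no nonunit factor that misses a
variable. So no variable divides it, and a `q`-integer linear factor of positive degree has at least
two terms, on a line whose direction `l` has no zero coordinate
(`exists_aligned_of_isQIntegerLinear`). The substitution attached to `l` is an injective monomial
map that sends `x^l` to `y^{l_n}` and a factor aligned with `l` to `F(y)` times a monomial. Hence
`F` divides the content `P`. As `l` has gcd 1, the coefficients whose gcd is `P` have the form `y^r
G(y^{l_n})`, so `P = Q(y^{l_n})` (`exists_eq_expand_of_isGCDOf`), and `Q(x^l)` divides `f`
(`IsTypeContent.substMono_dvd`). Comparing degrees, no aligned factor remains after the division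
(`IsTypeContent.not_aligned_of_eq_mul`), nor is there one if `P` is constant
(`IsTypeContent.natDegree_pos`).

No needed direction is lost in steps 6 and 7: multiplying by a polynomial with two terms leaves at
least two terms, so every line with direction `l` that meets the support meets it twice. A
functional that is constant exactly along these lines therefore exposes an edge with direction `l`,
and its negative exposes a second one unless the whole support lies on one line; in that case there
is only one edge and step 7 does nothing.

Types found at the variable `x_k` vanish at `k` but at no earlier coordinate
(`IsQILD.type_ne_zero`), and types from edges vanish nowhere, so all are distinct. The loops shrink
and recursive calls lose a variable; `Good` combines termination, progress and correctness, and
`GoodReturn` handles the stack. -/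

lemma mono_add (a b : Fin n → ℤ) : mono A (a + b) = mono A a * mono A b := by
  simp [mono, AddMonoidAlgebra.single_mul_single]

lemma mono_zero : mono A (0 : Fin n → ℤ) = 1 := rfl

lemma mono_pow (a : Fin n → ℤ) (k : ℕ) : mono A a ^ k = mono A (k • a) := by
  simp [mono, AddMonoidAlgebra.single_pow]

lemma isUnit_mono (a : Fin n → ℤ) : IsUnit (mono A a) :=
  IsUnit.of_mul_eq_one (mono A (-a)) (by rw [← mono_add, add_neg_cancel, mono_zero])

lemma coeff_mono_mul (a : Fin n → ℤ) (w : Laurent A n) (s : Fin n → ℤ) :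
    (mono A a * w).coeff s = w.coeff (s - a) := by
  rw [mono, AddMonoidAlgebra.coeff_single_mul_apply, one_mul, sub_eq_neg_add]

/-- An exponent vector with natural entries as an integer vector. -/
def intVec (m : Fin n →₀ ℕ) : Fin n → ℤ := fun i => (m i : ℤ)

lemma intVec_injective : Function.Injective (intVec (n := n)) := fun a b h => by
  ext i; simpa [intVec] using congrFun h i

lemma intVec_add (a b : Fin n →₀ ℕ) : intVec (a + b) = intVec a + intVec b := by
  ext i; simp [intVec]

lemma prod_mono_single_pow (m : Fin n →₀ ℕ) :
    (m.prod fun i e => mono A (Pi.single i (1 : ℤ)) ^ e) = mono A (intVec m) := by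
  induction m using Finsupp.induction_linear with
  | zero => simp [← mono_zero]; rfl
  | add f g hf hg =>
    rw [Finsupp.prod_add_index' (by simp) (by intros; rw [pow_add]), hf, hg, intVec_add, mono_add]
  | single i e =>
    rw [Finsupp.prod_single_index (by simp), mono_pow]
    congr 1
    ext j
    by_cases h : j = i
    · subst h; simp [intVec]
    · simp [intVec, h, Finsupp.single_eq_of_ne h]

lemma toLaurent_monomial (m : Fin n →₀ ℕ) (r : A) :
    toLaurent (MvPolynomial.monomial m r) = r • mono A (intVec m) := by
  rw [toLaurent, MvPolynomial.aeval_monomial, prod_mono_single_pow, Algebra.smul_def]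

lemma toLaurent_eq_sum (f : MvPolynomial (Fin n) A) :
    toLaurent f = ∑ m ∈ f.support, f.coeff m • mono A (intVec m) := by
  conv_lhs => rw [f.as_sum, map_sum]
  exact Finset.sum_congr rfl fun m _ => toLaurent_monomial m _

lemma coeff_toLaurent_apply (f : MvPolynomial (Fin n) A) (s : Fin n → ℤ) :
    (toLaurent f).coeff s = ∑ m ∈ f.support, if intVec m = s then f.coeff m else 0 := by
  classical
  rw [toLaurent_eq_sum]
  simp [mono, Finsupp.finsetSum_apply, Finsupp.single_apply]

lemma coeff_toLaurent (f : MvPolynomial (Fin n) A) (m : Fin n →₀ ℕ) :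
    (toLaurent f).coeff (intVec m) = f.coeff m := by
  classical
  rw [coeff_toLaurent_apply]
  simp [intVec_injective.eq_iff]
  tauto

lemma exists_of_coeff_toLaurent_ne_zero {f : MvPolynomial (Fin n) A} {s : Fin n → ℤ}
    (h : (toLaurent f).coeff s ≠ 0) : ∃ m ∈ f.support, intVec m = s := by
  rw [coeff_toLaurent_apply] at h
  obtain ⟨m, hm, h⟩ := Finset.exists_ne_zero_of_sum_ne_zero h
  exact ⟨m, hm, by_contra fun h' => h (if_neg h')⟩

lemma toLaurent_injective : Function.Injective (toLaurent (A := A) (n := n)) := fun f g h => by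
  ext m; rw [← coeff_toLaurent, ← coeff_toLaurent, h]

lemma toLaurent_C (r : A) : toLaurent (MvPolynomial.C r : MvPolynomial (Fin n) A) = r • 1 := by
  rw [← MvPolynomial.algebraMap_eq, AlgHom.commutes, Algebra.algebraMap_eq_smul_one]

lemma toLaurent_monomial_one (b : Fin n → ℕ) :
    toLaurent (MvPolynomial.monomial (Finsupp.equivFunOnFinite.symm b) (1 : A)) =
      mono A (fun i => (b i : ℤ)) := by
  rw [toLaurent_monomial, one_smul]; rfl

lemma X_dvd_iff_support {i : Fin n} {h : MvPolynomial (Fin n) A} :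
    MvPolynomial.X i ∣ h ↔ ∀ m ∈ h.support, m i ≠ 0 := by
  classical
  constructor
  · rintro ⟨g, rfl⟩ m hm h0
    rw [MvPolynomial.mem_support_iff, MvPolynomial.coeff_X_mul'] at hm
    simp [h0] at hm
  · intro h'
    rw [h.as_sum]
    exact Finset.dvd_sum fun m hm => MvPolynomial.X_dvd_monomial.2 (Or.inr (h' m hm))

lemma exists_toLaurent_eq_mono_mul (w : Laurent A n) :
    ∃ (h : MvPolynomial (Fin n) A) (b : Fin n → ℕ),
      toLaurent h = mono A (fun i => (b i : ℤ)) * w := by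
  induction w using AddMonoidAlgebra.induction_linear with
  | zero => exact ⟨0, 0, by simp⟩
  | add f g hf hg =>
    obtain ⟨h₁, b₁, e₁⟩ := hf
    obtain ⟨h₂, b₂, e₂⟩ := hg
    refine ⟨MvPolynomial.monomial (Finsupp.equivFunOnFinite.symm b₂) 1 * h₁ +
      MvPolynomial.monomial (Finsupp.equivFunOnFinite.symm b₁) 1 * h₂, b₁ + b₂, ?_⟩
    have : (fun i => (((b₁ + b₂) i : ℕ) : ℤ)) = (fun i => (b₁ i : ℤ)) + fun i => (b₂ i : ℤ) := by
      ext i; simp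
    rw [map_add, map_mul, map_mul, toLaurent_monomial_one, toLaurent_monomial_one, e₁, e₂, this,
      mono_add]
    ring
  | single a r =>
    refine ⟨MvPolynomial.monomial (Finsupp.equivFunOnFinite.symm fun i => (a i).toNat) r,
      fun i => (-a i).toNat, ?_⟩
    rw [toLaurent_monomial, mono, mono, AddMonoidAlgebra.single_mul_single]
    simp only [AddMonoidAlgebra.smul_single, smul_eq_mul, mul_one, one_mul]
    congr 1
    ext i
    simp [intVec]
    omega

/-- Start from any fraction with monomial denominator and cancel common variables; each cancellation
lowers the sum of the exponents of the denominator. -/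
lemma exists_isNumDen (w : Laurent A n) :
    ∃ (h : MvPolynomial (Fin n) A) (b : Fin n → ℕ), IsNumDen w h b := by
  classical
  obtain ⟨h₀, b₀, e₀⟩ := exists_toLaurent_eq_mono_mul w
  induction hN : ∑ i, b₀ i using Nat.strong_induction_on generalizing h₀ b₀ with
  | _ N ih =>
    by_cases H : ∀ i, b₀ i = 0 ∨ ¬ (MvPolynomial.X i ∣ h₀)
    · exact ⟨h₀, b₀, e₀, H⟩
    push Not at H
    obtain ⟨i, hi, g, hg⟩ := H
    have hb : (fun j => (b₀ j : ℤ)) =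
        Pi.single i 1 + fun j => ((Function.update b₀ i (b₀ i - 1) j : ℕ) : ℤ) := by
      ext j
      by_cases h : j = i
      · subst h; simp; omega
      · simp [h]
    refine ih _ ?_ g (Function.update b₀ i (b₀ i - 1)) ?_ rfl
    · rw [← hN]
      refine Finset.sum_lt_sum (fun j _ => ?_) ⟨i, Finset.mem_univ _, ?_⟩
      · by_cases h : j = i
        · subst h; simp
        · simp [h]
      · simp; omega
    · apply (isUnit_mono (A := A) (Pi.single i (1 : ℤ))).mul_left_cancel
      rw [← mul_assoc, ← mono_add, ← hb, ← e₀, hg, map_mul]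
      simp [toLaurent]

end Laurent

section Domain

variable {A : Type*} [CommRing A] [IsDomain A] {n : ℕ}

/-- Divisibility of polynomials not divisible by a variable may be tested on Laurent polynomials. -/
lemma dvd_of_toLaurent_dvd [UniqueFactorizationMonoid A] {h f : MvPolynomial (Fin n) A}
    (hX : ∀ i, ¬ (MvPolynomial.X i ∣ h)) (hd : toLaurent h ∣ toLaurent f) : h ∣ f := by
  obtain ⟨w, hw⟩ := hd
  obtain ⟨g, b, hg⟩ := exists_toLaurent_eq_mono_mul w
  have e : MvPolynomial.monomial (Finsupp.equivFunOnFinite.symm b) 1 * f = h * g := by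
    apply toLaurent_injective
    rw [map_mul, map_mul, toLaurent_monomial_one, hw, hg]; ring
  have hm : MvPolynomial.monomial (Finsupp.equivFunOnFinite.symm b) (1 : A) =
      ∏ i, MvPolynomial.X i ^ b i := by
    rw [MvPolynomial.monomial_eq]
    simp [Finsupp.prod_fintype]
  -- No variable divides `h`, so `h` is relatively prime to the monomial that clears the denominator
  -- of the cofactor.
  have hr : IsRelPrime h (MvPolynomial.monomial (Finsupp.equivFunOnFinite.symm b) 1) := by
    rw [hm]
    refine IsRelPrime.prod_right fun i _ => IsRelPrime.pow_right ?_
    exact ((MvPolynomial.X_prime (i := i)).irreducible.isRelPrime_iff_not_dvd.2 (hX i)).symm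
  exact hr.dvd_of_dvd_mul_left (Dvd.intro _ e.symm)

end Domain

/-! ### Greatest common divisors and contents -/

section GCD

variable {A : Type*} [CommRing A] [IsDomain A] [UniqueFactorizationMonoid A]

lemma exists_isGCDOf_of_finite {S : Set A} (hS : S.Finite) : ∃ g, IsGCDOf S g := by
  obtain ⟨_⟩ : Nonempty (NormalizedGCDMonoid A) := inferInstance
  refine ⟨hS.toFinset.gcd id, fun a ha => ?_, fun d hd => ?_⟩
  · exact Finset.gcd_dvd (f := id) (hS.mem_toFinset.2 ha)
  · exact Finset.dvd_gcd fun a ha => hd a (hS.mem_toFinset.1 ha)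

lemma exists_isContent {n : ℕ} (p : MvPolynomial (Fin n) A) : ∃ c, IsContent p c :=
  exists_isGCDOf_of_finite ((p.support.finite_toSet.image p.coeff).insert 0 |>.subset (by
    rintro _ ⟨i, rfl⟩
    by_cases h : p.coeff i = 0
    · simp [h]
    · exact Set.mem_insert_of_mem _ ⟨i, by simpa using h, rfl⟩))

lemma exists_isContentAt {n : ℕ} (i : Fin (n + 1)) (f : MvPolynomial (Fin (n + 1)) A) :
    ∃ g, IsContentAt i f g :=
  exists_isGCDOf_of_finite
    (((asPolyIn i f).support.finite_toSet.image (asPolyIn i f).coeff).insert 0 |>.subset (by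
      rintro _ ⟨k, rfl⟩
      by_cases h : (asPolyIn i f).coeff k = 0
      · simp [h]
      · exact Set.mem_insert_of_mem _ ⟨k, by simpa using h, rfl⟩))

/-- A polynomial whose only constant divisors are units. -/
def PrimC {n : ℕ} (f : MvPolynomial (Fin n) A) : Prop :=
  ∀ r : A, MvPolynomial.C r ∣ f → IsUnit r

variable {n : ℕ}

/-- Replaces the gcd condition by one on divisors, which passes to factors at once. -/
lemma isPrimitive_iff_primC {f : MvPolynomial (Fin n) A} : IsPrimitive f ↔ PrimC f := by
  constructor
  · rintro ⟨-, h⟩ r hr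
    rw [MvPolynomial.C_dvd_iff_dvd_coeff] at hr
    exact isUnit_of_dvd_one (h r (by rintro _ ⟨m, rfl⟩; exact hr m))
  · intro h
    refine ⟨fun a _ => one_dvd a, fun d hd => (h d ?_).dvd⟩
    rw [MvPolynomial.C_dvd_iff_dvd_coeff]
    exact fun m => hd _ ⟨m, rfl⟩

lemma PrimC.of_dvd {f g : MvPolynomial (Fin n) A} (hg : PrimC g) (h : f ∣ g) : PrimC f :=
  fun r hr => hg r (hr.trans h)

lemma PrimC.one : PrimC (1 : MvPolynomial (Fin n) A) := fun r hr => by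
  rw [MvPolynomial.C_dvd_iff_dvd_coeff] at hr
  exact isUnit_of_dvd_one (by simpa using hr 0)

lemma PrimC.ne_zero {f : MvPolynomial (Fin n) A} (h : PrimC f) : f ≠ 0 := by
  rintro rfl
  exact not_isUnit_zero (h 0 (dvd_zero _))

/-- Gauss's lemma: a prime of `A` stays prime as a constant polynomial, so it would divide one of
the two factors. -/
lemma PrimC.mul {f g : MvPolynomial (Fin n) A} (hf : PrimC f) (hg : PrimC g) : PrimC (f * g) := by
  intro r hr
  by_contra hu
  rcases eq_or_ne r 0 with rfl | h0
  · rw [MvPolynomial.C_0, zero_dvd_iff, mul_eq_zero] at hr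
    exact hr.elim hf.ne_zero hg.ne_zero
  obtain ⟨q, hq, hqr⟩ := WfDvdMonoid.exists_irreducible_factor hu h0
  have hp : Prime (MvPolynomial.C q : MvPolynomial (Fin n) A) :=
    (MvPolynomial.prime_C_iff _).2 hq.prime
  rcases hp.dvd_or_dvd ((map_dvd MvPolynomial.C hqr).trans hr) with h | h
  · exact hq.not_isUnit (hf q h)
  · exact hq.not_isUnit (hg q h)

lemma IsContent.primC {p f : MvPolynomial (Fin n) A} {c : A} (hc : IsContent p c)
    (hf : p = MvPolynomial.C c * f) (hp : p ≠ 0) : PrimC f := by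
  have hc0 : c ≠ 0 := by rintro rfl; simp [hf] at hp
  intro r hr
  have h1 : MvPolynomial.C (c * r) ∣ p := by
    rw [hf, map_mul]; exact mul_dvd_mul_left _ hr
  rw [MvPolynomial.C_dvd_iff_dvd_coeff] at h1
  have h2 := hc.2 (c * r) (by rintro _ ⟨m, rfl⟩; exact h1 m)
  exact isUnit_of_dvd_one ((mul_dvd_mul_iff_left hc0).1 (by simpa using h2))

lemma IsContent.exists_eq_mul {p : MvPolynomial (Fin n) A} {c : A} (hc : IsContent p c) :
    ∃ f, p = MvPolynomial.C c * f :=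
  MvPolynomial.C_dvd_iff_dvd_coeff _ _ |>.2 fun m => hc.1 _ ⟨m, rfl⟩

end GCD

/-! ### Polynomials in one variable over the polynomials in the others -/

section AsPolyIn

variable {A : Type*} [CommRing A] {n : ℕ}

lemma asPolyIn_embedAt (i : Fin (n + 1)) (g : MvPolynomial (Fin n) A) :
    asPolyIn i (embedAt i g) = Polynomial.C g := by
  have : (asPolyIn (A := A) i).comp (embedAt i) = Polynomial.CAlgHom := by
    ext j
    simp [asPolyIn, embedAt]
  simpa using DFunLike.congr_fun this g

lemma asPolyIn_X (i : Fin (n + 1)) :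
    asPolyIn i (MvPolynomial.X i : MvPolynomial (Fin (n + 1)) A) = Polynomial.X := by
  simp [asPolyIn]

/-- The inverse of `asPolyIn`. -/
def ofPolyIn (i : Fin (n + 1)) :
    Polynomial (MvPolynomial (Fin n) A) →+* MvPolynomial (Fin (n + 1)) A :=
  Polynomial.eval₂RingHom (embedAt i).toRingHom (MvPolynomial.X i)

lemma ofPolyIn_C (i : Fin (n + 1)) (g : MvPolynomial (Fin n) A) :
    ofPolyIn i (Polynomial.C g) = embedAt i g := by
  simp [ofPolyIn]

lemma ofPolyIn_asPolyIn (i : Fin (n + 1)) (f : MvPolynomial (Fin (n + 1)) A) :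
    ofPolyIn i (asPolyIn i f) = f := by
  have : (ofPolyIn (A := A) i).comp (asPolyIn i).toRingHom = RingHom.id _ := by
    apply MvPolynomial.ringHom_ext
    · intro r
      have : asPolyIn i (MvPolynomial.C r) =
          Polynomial.C (MvPolynomial.C r : MvPolynomial (Fin n) A) := by
        rw [← asPolyIn_embedAt i]; simp [embedAt]
      simp [this, ofPolyIn_C, embedAt]
    · intro j
      refine Fin.succAboveCases i ?_ (fun j => ?_) j
      · simp [asPolyIn_X, ofPolyIn]
      · have : (MvPolynomial.X (i.succAbove j) : MvPolynomial (Fin (n + 1)) A) =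
            embedAt i (MvPolynomial.X j) := by simp [embedAt]
        simp [this, asPolyIn_embedAt, ofPolyIn_C]
  exact DFunLike.congr_fun this f

/-- `ofPolyIn i` undoes `asPolyIn i`, so divisibility may be tested after the change of viewpoint,
where a polynomial free of `x_i` is a constant. -/
lemma embedAt_dvd_iff {i : Fin (n + 1)} {g : MvPolynomial (Fin n) A}
    {f : MvPolynomial (Fin (n + 1)) A} :
    embedAt i g ∣ f ↔ ∀ k, g ∣ (asPolyIn i f).coeff k := by
  rw [← Polynomial.C_dvd_iff_dvd_coeff]
  constructor
  · intro h
    rw [← asPolyIn_embedAt]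
    exact map_dvd _ h
  · intro h
    have := map_dvd (ofPolyIn i) h
    rwa [ofPolyIn_C, ofPolyIn_asPolyIn] at this

lemma IsContentAt.dvd {i : Fin (n + 1)} {f : MvPolynomial (Fin (n + 1)) A}
    {g : MvPolynomial (Fin n) A} (h : IsContentAt i f g) : embedAt i g ∣ f :=
  embedAt_dvd_iff.2 fun k => h.1 _ ⟨k, rfl⟩

/-- A polynomial whose only divisors that do not involve `x_i` are units. -/
def PrimAt (i : Fin (n + 1)) (f : MvPolynomial (Fin (n + 1)) A) : Prop :=
  ∀ g, embedAt i g ∣ f → IsUnit g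

lemma PrimAt.of_dvd {i : Fin (n + 1)} {f g : MvPolynomial (Fin (n + 1)) A} (hg : PrimAt i g)
    (h : f ∣ g) : PrimAt i f := fun r hr => hg r (hr.trans h)

variable [IsDomain A]

lemma IsContentAt.primAt {i : Fin (n + 1)} {f f' : MvPolynomial (Fin (n + 1)) A}
    {g : MvPolynomial (Fin n) A} (h : IsContentAt i f g) (hf : f = embedAt i g * f')
    (h0 : f ≠ 0) : PrimAt i f' := by
  intro r hr
  have hg0 : g ≠ 0 := by rintro rfl; simp [hf] at h0
  have h1 : embedAt i (g * r) ∣ f := by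
    rw [hf, map_mul]; exact mul_dvd_mul_left _ hr
  rw [embedAt_dvd_iff] at h1
  have h2 := h.2 (g * r) (by rintro _ ⟨m, rfl⟩; exact h1 m)
  exact isUnit_of_dvd_one ((mul_dvd_mul_iff_left hg0).1 (by simpa using h2))

/-- A divisor of a polynomial that does not involve `x_i` does not involve `x_i`. -/
lemma exists_embedAt_eq_of_dvd {i : Fin (n + 1)} {h : MvPolynomial (Fin (n + 1)) A}
    {g : MvPolynomial (Fin n) A} (hg : g ≠ 0) (hd : h ∣ embedAt i g) :
    ∃ h', h = embedAt i h' := by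
  have h1 : asPolyIn i h ∣ Polynomial.C g := by
    rw [← asPolyIn_embedAt]; exact map_dvd _ hd
  have h2 : (asPolyIn i h).natDegree = 0 := by
    have := Polynomial.natDegree_le_of_dvd h1 (Polynomial.C_ne_zero.2 hg)
    simpa using this
  rw [Polynomial.natDegree_eq_zero] at h2
  obtain ⟨h', e⟩ := h2
  exact ⟨h', by rw [← ofPolyIn_C, e, ofPolyIn_asPolyIn]⟩

lemma exists_embedAt_eq_of_support {i : Fin (n + 1)} {h : MvPolynomial (Fin (n + 1)) A}
    (hs : ∀ m ∈ h.support, m i = 0) : ∃ h', h = embedAt i h' := by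
  obtain ⟨q, hq⟩ := MvPolynomial.exists_rename_eq_of_vars_subset_range h i.succAbove
    Fin.succAbove_right_injective (by
      intro j hj
      rw [Finset.mem_coe, MvPolynomial.mem_vars_iff_mem_support] at hj
      obtain ⟨m, hm, hj⟩ := hj
      refine Fin.exists_succAbove_eq ?_
      rintro rfl
      exact (Finsupp.mem_support_iff.1 hj) (hs m hm))
  exact ⟨q, hq.symm⟩

lemma isUnit_of_isUnit_embedAt {i : Fin (n + 1)} {g : MvPolynomial (Fin n) A}
    (h : IsUnit (embedAt i g)) : IsUnit g := by
  have := h.map (asPolyIn i)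
  rwa [asPolyIn_embedAt, Polynomial.isUnit_C] at this

lemma irreducible_of_irreducible_embedAt {i : Fin (n + 1)} {g : MvPolynomial (Fin n) A}
    (h : Irreducible (embedAt i g)) : Irreducible g := by
  refine ⟨fun hu => h.not_isUnit (hu.map _), fun a b hab => ?_⟩
  rw [hab, map_mul] at h
  exact (h.isUnit_or_isUnit rfl).imp isUnit_of_isUnit_embedAt isUnit_of_isUnit_embedAt

end AsPolyIn

/-! ### Adding and removing one variable in Laurent polynomials -/

section Insert

variable {A : Type*} [CommRing A] {n : ℕ}

/-- Inserting a zero as `i`-th coordinate of an integer vector. -/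
def insertZero (i : Fin (n + 1)) : (Fin n → ℤ) →+ (Fin (n + 1) → ℤ) where
  toFun a := i.insertNth (α := fun _ => ℤ) 0 a
  map_zero' := by
    ext j; refine Fin.succAboveCases i ?_ (fun j => ?_) j <;> simp
  map_add' a b := by
    ext j; refine Fin.succAboveCases i ?_ (fun j => ?_) j <;> simp

lemma insertZero_apply (i : Fin (n + 1)) (a : Fin n → ℤ) :
    insertZero i a = i.insertNth (α := fun _ => ℤ) 0 a := rfl

lemma insertZero_injective (i : Fin (n + 1)) : Function.Injective (insertZero i) := fun a b h => by
  ext j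
  simpa [insertZero] using congrFun h (i.succAbove j)

/-- The inclusion of the Laurent polynomials in the variables other than `x_i`. -/
def embedLaurent (i : Fin (n + 1)) : Laurent A n →ₐ[A] Laurent A (n + 1) :=
  AddMonoidAlgebra.mapDomainAlgHom A A (insertZero i)

lemma embedLaurent_mono (i : Fin (n + 1)) (a : Fin n → ℤ) :
    embedLaurent i (mono A a) = mono A (insertZero i a) := by
  simp [embedLaurent, mono]

lemma embedLaurent_toLaurent (i : Fin (n + 1)) (g : MvPolynomial (Fin n) A) :
    embedLaurent i (toLaurent g) = toLaurent (embedAt i g) := by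
  have : (embedLaurent (A := A) i).comp toLaurent = toLaurent.comp (embedAt i) := by
    ext1 j
    simp only [AlgHom.comp_apply, toLaurent, embedAt, MvPolynomial.aeval_X, MvPolynomial.rename_X,
      embedLaurent_mono]
    congr 1
    ext k
    refine Fin.succAboveCases i ?_ (fun k => ?_) k
    · simp [insertZero]
    · simp [insertZero, Pi.single_apply]
  exact DFunLike.congr_fun this g

lemma embedLaurent_substMono (i : Fin (n + 1)) (P : Polynomial A) (l : Fin n → ℤ) :
    embedLaurent i (substMono P l) = substMono P (insertZero i l) := by
  rw [substMono, ← Polynomial.aeval_algHom_apply, embedLaurent_mono, substMono]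

/-- Setting `x_i = 1` in a Laurent polynomial. -/
def dropLaurent (i : Fin (n + 1)) : Laurent A (n + 1) →ₐ[A] Laurent A n :=
  AddMonoidAlgebra.mapDomainAlgHom A A
    (AddMonoidHom.mk' (fun (a : Fin (n + 1) → ℤ) (j : Fin n) => a (i.succAbove j))
      fun _ _ => rfl)

lemma dropLaurent_mono (i : Fin (n + 1)) (a : Fin (n + 1) → ℤ) :
    dropLaurent i (mono A a) = mono A fun j => a (i.succAbove j) := by
  simp [dropLaurent, mono]

lemma dropLaurent_embedLaurent (i : Fin (n + 1)) (w : Laurent A n) :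
    dropLaurent i (embedLaurent i w) = w := by
  have : (dropLaurent (A := A) i).comp (embedLaurent i) = AlgHom.id A _ := by
    ext a
    simp [dropLaurent, embedLaurent, insertZero]
  exact DFunLike.congr_fun this w

/-- Setting `x_i = 1` undoes the embedding and preserves the shape `x^a P(x^l)`. -/
lemma IsQIntegerLinear.of_embedAt {i : Fin (n + 1)} {h : MvPolynomial (Fin n) A}
    (hq : IsQIntegerLinear (embedAt i h)) : IsQIntegerLinear h := by
  obtain ⟨P, a, l, e⟩ := hq
  refine ⟨P, fun j => a (i.succAbove j), fun j => l (i.succAbove j), ?_⟩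
  rw [← dropLaurent_embedLaurent i (toLaurent h), embedLaurent_toLaurent, e, map_mul,
    dropLaurent_mono, substMono, ← Polynomial.aeval_algHom_apply, dropLaurent_mono, substMono]

lemma embedLaurent_value (i : Fin (n + 1)) (d : Decomp A (n + 1)) (e : Decomp A n) :
    (d.merge i e).value = d.value * embedLaurent i e.value := by
  have h1 : (e.factors.map fun t => embedLaurent i (substMono t.2 t.1)) =
      e.factors.map fun t => substMono t.2 (i.insertNth (α := fun _ => ℤ) 0 t.1) := by
    refine List.map_congr_left fun t _ => ?_
    rw [embedLaurent_substMono, insertZero_apply]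
  have h2 : (fun j => (((d.α + i.insertNth (α := fun _ => ℕ) 0 e.α) j : ℕ) : ℤ)) =
      (fun j => (d.α j : ℤ)) + insertZero i fun j => (e.α j : ℤ) := by
    ext j
    refine Fin.succAboveCases i ?_ (fun j => ?_) j <;> simp [insertZero]
  simp only [Decomp.value, Decomp.merge, map_mul, map_list_prod, List.map_map,
    embedLaurent_mono, embedLaurent_toLaurent, h2, mono_add, List.map_append, List.prod_append,
    Algebra.smul_def, Function.comp_def, h1, AlgHom.commutes]
  ring

end Insert

/-! ### Univariate polynomials in a power of the variable -/

section Expand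

variable {A : Type*} [CommRing A]

lemma expand_contract_of_dvd {N : ℕ} (hN : 0 < N) {F : Polynomial A}
    (h : ∀ k, F.coeff k ≠ 0 → N ∣ k) : F = Polynomial.expand A N (Polynomial.contract N F) := by
  ext k
  rw [Polynomial.coeff_expand hN, Polynomial.coeff_contract hN.ne']
  split_ifs with hk
  · rw [Nat.div_mul_cancel hk]
  · exact by_contra fun h' => hk (h k h')

/-- All exponents are congruent modulo `N`; splitting off the lowest power leaves exponents
divisible by `N`. -/
lemma exists_eq_X_pow_mul_expand {N : ℕ} (hN : 0 < N) {F : Polynomial A}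
    (h : ∀ k k', F.coeff k ≠ 0 → F.coeff k' ≠ 0 → (N : ℤ) ∣ (k : ℤ) - k') :
    ∃ r G, F = Polynomial.X ^ r * Polynomial.expand A N G := by
  by_cases h0 : F = 0
  · exact ⟨0, 0, by simp [h0]⟩
  have ht : F.coeff F.natTrailingDegree ≠ 0 := by
    rw [← Polynomial.trailingCoeff]; exact Polynomial.trailingCoeff_nonzero_iff_nonzero.2 h0
  obtain ⟨F₁, hF₁⟩ : Polynomial.X ^ F.natTrailingDegree ∣ F :=
    Polynomial.X_pow_dvd_iff.2 fun d hd => Polynomial.coeff_eq_zero_of_lt_natTrailingDegree hd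
  refine ⟨F.natTrailingDegree, Polynomial.contract N F₁, ?_⟩
  rw [← expand_contract_of_dvd hN]
  · exact hF₁
  intro k hk
  have h1 : F.coeff (k + F.natTrailingDegree) ≠ 0 := by
    have e : F.coeff (k + F.natTrailingDegree) = F₁.coeff k :=
      (congrArg (fun p => p.coeff (k + F.natTrailingDegree)) hF₁).trans
        (by rw [mul_comm, Polynomial.coeff_mul_X_pow])
    rwa [e]
  have := h _ _ h1 ht
  push_cast at this
  rw [add_sub_cancel_right] at this
  exact_mod_cast this

variable [IsDomain A] [UniqueFactorizationMonoid A]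

/-- A greatest common divisor of polynomials of the form `y ^ r * G (y ^ N)` that is not divisible
by `y` is a polynomial in `y ^ N`. -/
lemma exists_eq_expand_of_isGCDOf {ι : Type*} {N : ℕ} (hN : 0 < N) {F : ι → Polynomial A}
    (hF : ∀ i, ∃ r G, F i = Polynomial.X ^ r * Polynomial.expand A N G)
    {P : Polynomial A} (hP : IsGCDOf (Set.range F) P) (hP0 : P.coeff 0 ≠ 0) :
    ∃ Q, P = Polynomial.expand A N Q := by
  obtain ⟨_⟩ : Nonempty (NormalizedGCDMonoid A) := inferInstance
  choose r G hF using hF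
  set K := FractionRing A
  set φ := algebraMap A K
  have hφ : Function.Injective φ := IsFractionRing.injective A K
  -- Over the fraction field `P` is coprime to `y`, so the factors `y ^ r i` can be dropped.
  have hPK : IsCoprime (P.map φ) Polynomial.X := by
    refine (Polynomial.prime_X.irreducible.coprime_iff_not_dvd.2 ?_).symm
    rw [Polynomial.X_dvd_iff, Polynomial.coeff_map]
    exact fun h => hP0 (hφ (by simpa using h))
  -- The family may be infinite, so the gcd of the `G i` over `K` is taken as a generator of the
  -- ideal they span.
  set J : Ideal (Polynomial K) := Ideal.span (Set.range fun i => (G i).map φ)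
  obtain ⟨g, hg⟩ : ∃ g, J = Ideal.span {g} := (IsPrincipalIdealRing.principal J).principal
  have hPg : P.map φ ∣ Polynomial.expand K N g := by
    -- Divisibility by `P` after `y ↦ y^N` defines an ideal; it contains the generators `G i`, hence
    -- also `g`.
    have hle : J ≤ (Ideal.span {P.map φ}).comap (Polynomial.expand K N).toRingHom := by
      rw [Ideal.span_le]
      rintro _ ⟨i, rfl⟩
      simp only [SetLike.mem_coe, Ideal.mem_comap, Ideal.mem_span_singleton]
      have h1 : P.map φ ∣ (F i).map φ := Polynomial.map_dvd φ (hP.1 _ ⟨i, rfl⟩)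
      rw [hF i, Polynomial.map_mul, Polynomial.map_pow, Polynomial.map_X,
        Polynomial.map_expand] at h1
      exact (hPK.pow_right).dvd_of_dvd_mul_left h1
    have := hle (hg ▸ Ideal.mem_span_singleton_self g)
    simpa [Ideal.mem_comap, Ideal.mem_span_singleton] using this
  have hgG : ∀ i, g ∣ (G i).map φ := fun i => by
    rw [← Ideal.mem_span_singleton, ← hg]
    exact Ideal.subset_span ⟨i, rfl⟩
  have hP_ne : P ≠ 0 := by rintro rfl; simp at hP0
  have hg0 : g ≠ 0 := by
    rintro rfl
    refine hP_ne (zero_dvd_iff.1 (hP.2 0 ?_))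
    rintro _ ⟨i, rfl⟩
    have := zero_dvd_iff.1 (hgG i)
    rw [Polynomial.map_eq_zero_iff hφ] at this
    rw [hF i, this, map_zero, mul_zero]
  -- Return to `A[y]`: clear the denominators of `g`, then take the primitive part.
  obtain ⟨b, hb, hbg⟩ := IsLocalization.integerNormalization_spec (nonZeroDivisors A) g
  set g₁ := IsLocalization.integerNormalization (nonZeroDivisors A) g
  have hb0 : φ b ≠ 0 := fun h => nonZeroDivisors.ne_zero hb (hφ (by simpa using h))
  have hbg' : g₁.map φ = Polynomial.C (φ b) * g := by
    rw [← Polynomial.smul_eq_C_mul]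
    exact hbg.trans (algebraMap_smul K b g).symm
  have hg₁0 : g₁ ≠ 0 := by
    intro h
    rw [h, Polynomial.map_zero] at hbg'
    exact mul_ne_zero (Polynomial.C_ne_zero.2 hb0) hg0 hbg'.symm
  have hdeg : g₁.primPart.natDegree = g.natDegree := by
    rw [Polynomial.natDegree_primPart, ← Polynomial.natDegree_map_eq_of_injective hφ, hbg',
      Polynomial.natDegree_C_mul hb0]
  have hprim : (Polynomial.expand A N g₁.primPart).IsPrimitive := by
    intro a ha
    refine g₁.isPrimitive_primPart a ?_
    rw [Polynomial.C_dvd_iff_dvd_coeff] at ha ⊢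
    intro k
    simpa [Polynomial.coeff_expand_mul hN] using ha (k * N)
  have hdvd : Polynomial.expand A N g₁.primPart ∣ P := by
    refine hP.2 _ ?_
    rintro _ ⟨i, rfl⟩
    refine hprim.dvd_of_fraction_map_dvd_fraction_map (K := K) ?_
    rw [hF i, Polynomial.map_mul, Polynomial.map_expand, Polynomial.map_expand]
    refine Dvd.dvd.mul_left (map_dvd _ ?_) _
    refine (Polynomial.map_dvd φ g₁.primPart_dvd).trans ?_
    change g₁.map φ ∣ _
    rw [hbg']
    exact (((Polynomial.isUnit_C.2 hb0.isUnit).mul_left_dvd).2 dvd_rfl).trans (hgG i)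
  obtain ⟨t, ht⟩ := hdvd
  -- The divisor `g₁.primPart (y^N)` of `P` has at least the degree of `P`, so the quotient is a
  -- constant.
  have hle : P.natDegree ≤ g.natDegree * N := by
    rw [← Polynomial.natDegree_map_eq_of_injective hφ, ← Polynomial.natDegree_expand]
    exact Polynomial.natDegree_le_of_dvd hPg (by simpa using (Polynomial.expand_ne_zero hN).2 hg0)
  have ht0 : t ≠ 0 := by rintro rfl; simp at ht; exact hP_ne ht
  rw [ht, Polynomial.natDegree_mul hprim.ne_zero ht0, Polynomial.natDegree_expand, hdeg] at hle
  obtain ⟨τ, rfl⟩ := Polynomial.natDegree_eq_zero.1 (show t.natDegree = 0 by omega)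
  exact ⟨g₁.primPart * Polynomial.C τ, by rw [ht, map_mul, Polynomial.expand_C]⟩

/-- A product with a polynomial that has two terms has two terms. -/
lemma exists_coeff_mul_ne_zero {F W : Polynomial A} {i j : ℕ} (hij : i ≠ j) (hi : F.coeff i ≠ 0)
    (hj : F.coeff j ≠ 0) (hW : W ≠ 0) (k : ℕ) : ∃ k', k' ≠ k ∧ (F * W).coeff k' ≠ 0 := by
  have hF : F ≠ 0 := by rintro rfl; simp at hi
  have hFW : F * W ≠ 0 := mul_ne_zero hF hW
  have h1 := Polynomial.natDegree_mul hF hW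
  have h2 := Polynomial.natTrailingDegree_mul hF hW
  have h3 := Polynomial.natTrailingDegree_le_natDegree W
  have h4 := Polynomial.natTrailingDegree_le_of_ne_zero hi
  have h5 := Polynomial.natTrailingDegree_le_of_ne_zero hj
  have h6 := Polynomial.le_natDegree_of_ne_zero hi
  have h7 := Polynomial.le_natDegree_of_ne_zero hj
  -- Lowest and highest degrees add under multiplication, so they differ for `F * W`, and one of
  -- them is not `k`.
  by_cases hk : (F * W).natDegree = k
  · refine ⟨(F * W).natTrailingDegree, by omega, ?_⟩
    rw [← Polynomial.trailingCoeff]; exact Polynomial.trailingCoeff_nonzero_iff_nonzero.2 hFW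
  · exact ⟨_, hk, by rwa [← Polynomial.leadingCoeff, Polynomial.leadingCoeff_ne_zero]⟩

end Expand

/-! ### Laurent polynomials along an injective change of exponents -/

section MapDomain

variable {A G H : Type*} [CommRing A] [AddCommGroup G] [AddCommGroup H]

/-- Restriction of the exponents of a Laurent polynomial along an injective map. -/
def restrictExp (T : G →+ H) (hT : Function.Injective T) (z : AddMonoidAlgebra A H) :
    AddMonoidAlgebra A G :=
  .ofCoeff (z.coeff.comapDomain T hT.injOn)

lemma coeff_restrictExp (T : G →+ H) (hT : Function.Injective T) (z : AddMonoidAlgebra A H)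
    (m : G) : (restrictExp T hT z).coeff m = z.coeff (T m) := rfl

/-- Multiplication by an element supported on the image of `T` moves no exponent into or out of that
image. -/
lemma restrictExp_mul (T : G →+ H) (hT : Function.Injective T) (a : AddMonoidAlgebra A G)
    (z : AddMonoidAlgebra A H) :
    restrictExp T hT (AddMonoidAlgebra.mapDomainAlgHom A A T a * z) = a * restrictExp T hT z := by
  have hadd : ∀ x y, restrictExp (A := A) T hT (x + y) = restrictExp T hT x + restrictExp T hT y :=
    fun x y => by ext m; simp [coeff_restrictExp]
  induction a using AddMonoidAlgebra.induction_linear with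
  | zero => ext m; simp [coeff_restrictExp]
  | add f g hf hg => rw [map_add, add_mul, hadd, hf, hg, add_mul]
  | single k r =>
    ext m
    simp [coeff_restrictExp, AddMonoidAlgebra.coeff_single_mul_apply]

/-- The given cofactor may have exponents outside the image of `T`; its restriction is still a
cofactor. -/
lemma dvd_of_mapDomain_dvd (T : G →+ H) (hT : Function.Injective T) {a b : AddMonoidAlgebra A G}
    (h : AddMonoidAlgebra.mapDomainAlgHom A A T a ∣ AddMonoidAlgebra.mapDomainAlgHom A A T b) :
    a ∣ b := by
  obtain ⟨z, hz⟩ := h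
  refine ⟨restrictExp T hT z, ?_⟩
  rw [← restrictExp_mul, ← hz]
  ext m
  have := congrArg (fun w => w.coeff m) (restrictExp_mul T hT b (1 : AddMonoidAlgebra A H))
  have h1 : restrictExp T hT (1 : AddMonoidAlgebra A H) = 1 := by
    ext k
    classical
    have h0 : 0 = T k ↔ 0 = k := by rw [eq_comm, map_eq_zero_iff T hT, eq_comm]
    simp [coeff_restrictExp, AddMonoidAlgebra.one_def, Finsupp.single_apply, h0]
  rw [h1, mul_one, mul_one] at this
  exact this.symm

end MapDomain

/-! ### Substituted monomials -/

section SubstMono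

variable {A : Type*} [CommRing A] {n : ℕ}

lemma substMono_eq_sum (P : Polynomial A) (l : Fin n → ℤ) :
    substMono P l = ∑ k ∈ P.support, P.coeff k • mono A (k • l) := by
  rw [substMono, Polynomial.aeval_def, Polynomial.eval₂_eq_sum, Polynomial.sum]
  simp only [mono_pow, Algebra.smul_def]

lemma coeff_substMono_apply (P : Polynomial A) (l : Fin n → ℤ) (s : Fin n → ℤ) :
    (substMono P l).coeff s = ∑ k ∈ P.support, if k • l = s then P.coeff k else 0 := by
  classical
  rw [substMono_eq_sum]
  simp [mono, Finsupp.finsetSum_apply, Finsupp.single_apply]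

lemma exists_of_coeff_substMono_ne_zero {P : Polynomial A} {l s : Fin n → ℤ}
    (h : (substMono P l).coeff s ≠ 0) : ∃ k, P.coeff k ≠ 0 ∧ k • l = s := by
  rw [coeff_substMono_apply] at h
  obtain ⟨k, hk, h⟩ := Finset.exists_ne_zero_of_sum_ne_zero h
  exact ⟨k, Polynomial.mem_support_iff.1 hk, by_contra fun h' => h (if_neg h')⟩

lemma coeff_substMono (P : Polynomial A) {l : Fin n → ℤ} (hl : l ≠ 0) (k : ℕ) :
    (substMono P l).coeff (k • l) = P.coeff k := by
  classical
  rw [coeff_substMono_apply]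
  have : ∀ k' : ℕ, k' • l = k • l ↔ k' = k := fun k' => by
    rw [← natCast_zsmul, ← natCast_zsmul, smul_left_inj hl]; simp
  simp only [this, Finset.sum_ite_eq', Polynomial.mem_support_iff, ne_eq, ite_not]
  split_ifs with h <;> simp [h]

/-- The numerator of `P(x^l)` with `P(0) ≠ 0` is not divisible by a variable. -/
lemma IsNumDen.not_X_dvd {P : Polynomial A} {l : Fin n → ℤ} {h : MvPolynomial (Fin n) A}
    {b : Fin n → ℕ} (hh : IsNumDen (substMono P l) h b) (hl : l ≠ 0) (hP : P.coeff 0 ≠ 0)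
    (i : Fin n) : ¬ MvPolynomial.X i ∣ h := by
  rcases hh.2 i with hb | hX
  · intro hX
    -- The constant term of `P` sits at the exponent `b` of the numerator, and `b i = 0`, so this
    -- term is free of `x_i`.
    have h1 : (toLaurent h).coeff (fun i => (b i : ℤ)) = P.coeff 0 := by
      rw [hh.1, coeff_mono_mul, sub_self, ← coeff_substMono P hl 0, zero_smul]
    obtain ⟨m, hm, e⟩ := exists_of_coeff_toLaurent_ne_zero (h1 ▸ hP)
    refine X_dvd_iff_support.1 hX m hm ?_
    have := congrFun e i
    simp only [intVec] at this
    omega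
  · exact hX

/-- The numerator of a substituted monomial lies over the line with that direction. -/
lemma IsNumDen.exists_of_mem_support {P : Polynomial A} {l : Fin n → ℤ}
    {h : MvPolynomial (Fin n) A} {b : Fin n → ℕ} (hh : IsNumDen (substMono P l) h b)
    {m : Fin n →₀ ℕ} (hm : m ∈ h.support) :
    ∃ k : ℕ, P.coeff k ≠ 0 ∧ intVec m = (fun i => (b i : ℤ)) + k • l := by
  have h1 : (toLaurent h).coeff (intVec m) ≠ 0 := by
    rw [coeff_toLaurent]; exact MvPolynomial.mem_support_iff.1 hm
  rw [hh.1, coeff_mono_mul] at h1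
  obtain ⟨k, hk, e⟩ := exists_of_coeff_substMono_ne_zero h1
  exact ⟨k, hk, by rw [e]; abel⟩

lemma IsNumDen.exists_mem_support {P : Polynomial A} {l : Fin n → ℤ} (hl : l ≠ 0)
    {h : MvPolynomial (Fin n) A} {b : Fin n → ℕ} (hh : IsNumDen (substMono P l) h b)
    {k : ℕ} (hk : P.coeff k ≠ 0) :
    ∃ m ∈ h.support, intVec m = (fun i => (b i : ℤ)) + k • l := by
  apply exists_of_coeff_toLaurent_ne_zero
  rw [hh.1, coeff_mono_mul, add_sub_cancel_left, coeff_substMono P hl]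
  exact hk

end SubstMono

/-- The support of `u` lies on a line with direction `l`. -/
def Aligned {A : Type*} [CommRing A] {n : ℕ} (l : Fin n → ℤ) (u : MvPolynomial (Fin n) A) : Prop :=
  ∃ a : Fin n → ℤ, ∀ m ∈ u.support, ∃ k : ℤ, intVec m = a + k • l

/-! ### The substitution attached to a type -/

section TypeSubst

variable {A : Type*} [CommRing A] {n : ℕ}

/-- The exponents of `x_1, …, x_{n-1}` after the substitution attached to `l`. -/
def sideHom (l : Fin (n + 1) → ℤ) : (Fin (n + 1) → ℤ) →+ (Fin n → ℤ) :=
  AddMonoidHom.mk' (fun a j => l (Fin.last n) * a j.castSucc - a (Fin.last n) * l j.castSucc)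
    fun a b => by ext j; simp; ring

lemma sideHom_apply (l a : Fin (n + 1) → ℤ) (j : Fin n) :
    sideHom l a j = l (Fin.last n) * a j.castSucc - a (Fin.last n) * l j.castSucc := rfl

lemma sideHom_self (l : Fin (n + 1) → ℤ) : sideHom l l = 0 := by
  ext j; simp [sideHom_apply]

lemma prod_typeSubst (l : Fin (n + 1) → ℤ) (m : Fin (n + 1) →₀ ℕ) :
    (m.prod fun i e => (Fin.snoc (α := fun _ => Laurent (Polynomial A) n)
      (fun i : Fin n => mono (Polynomial A) (Pi.single i (l (Fin.last n))))
      ((Polynomial.X : Polynomial A) • mono (Polynomial A) (fun i : Fin n => - l i.castSucc)) :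
        Fin (n + 1) → Laurent (Polynomial A) n) i ^ e) =
    (Polynomial.X ^ m (Fin.last n) : Polynomial A) •
      mono (Polynomial A) (sideHom l (intVec m)) := by
  induction m using Finsupp.induction_linear with
  | zero =>
    have : intVec (0 : Fin (n + 1) →₀ ℕ) = 0 := by ext; simp [intVec]
    simp [this, mono_zero]
  | add f g hf hg =>
    rw [Finsupp.prod_add_index' (by simp) (by intros; rw [pow_add]), hf, hg, intVec_add, map_add,
      mono_add, smul_mul_smul_comm, Finsupp.add_apply, pow_add]
  | single i e =>
    rw [Finsupp.prod_single_index (by simp)]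
    refine Fin.lastCases ?_ (fun i => ?_) i
    · rw [Fin.snoc_last, smul_pow, mono_pow, Finsupp.single_eq_same]
      congr 2
      ext j
      simp [sideHom_apply, intVec, Finsupp.single_eq_of_ne (Fin.castSucc_lt_last j).ne]
    · rw [Fin.snoc_castSucc, mono_pow, Finsupp.single_eq_of_ne (Fin.castSucc_lt_last i).ne',
        pow_zero, one_smul]
      congr 1
      ext j
      by_cases h : j = i
      · subst h
        simp [sideHom_apply, intVec, Finsupp.single_eq_of_ne (Fin.castSucc_lt_last j).ne', mul_comm]
      · simp [sideHom_apply, intVec, Finsupp.single_eq_of_ne (Fin.castSucc_lt_last i).ne', h,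
          Finsupp.single_eq_of_ne (fun h' => h (Fin.castSucc_injective _ h'))]

lemma typeSubst_monomial (l : Fin (n + 1) → ℤ) (m : Fin (n + 1) →₀ ℕ) (r : A) :
    typeSubst l (MvPolynomial.monomial m r) =
      (Polynomial.monomial (m (Fin.last n)) r) •
        mono (Polynomial A) (sideHom l (intVec m)) := by
  rw [typeSubst, MvPolynomial.aeval_monomial, prod_typeSubst, ← Algebra.smul_def,
    ← Polynomial.C_mul_X_pow_eq_monomial, ← Polynomial.smul_eq_C_mul, smul_assoc]

lemma typeSubst_mul (l : Fin (n + 1) → ℤ) (f g : MvPolynomial (Fin (n + 1)) A) :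
    typeSubst l (f * g) = typeSubst l f * typeSubst l g := map_mul _ _ _

lemma typeSubst_eq_sum (l : Fin (n + 1) → ℤ) (f : MvPolynomial (Fin (n + 1)) A) :
    typeSubst l f = ∑ m ∈ f.support, (Polynomial.monomial (m (Fin.last n)) (f.coeff m)) •
        mono (Polynomial A) (sideHom l (intVec m)) := by
  conv_lhs => rw [f.as_sum, typeSubst, map_sum]
  exact Finset.sum_congr rfl fun m _ => typeSubst_monomial l m _

lemma coeff_typeSubst_apply (l : Fin (n + 1) → ℤ) (f : MvPolynomial (Fin (n + 1)) A)
    (s : Fin n → ℤ) (k : ℕ) : ((typeSubst l f).coeff s).coeff k =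
      ∑ m ∈ f.support, if sideHom l (intVec m) = s ∧ m (Fin.last n) = k then f.coeff m else 0 := by
  classical
  rw [typeSubst_eq_sum]
  simp only [mono, AddMonoidAlgebra.smul_single, smul_eq_mul, mul_one, AddMonoidAlgebra.coeff_sum,
    AddMonoidAlgebra.coeff_single, Finsupp.finsetSum_apply, Finsupp.single_apply,
    Polynomial.finsetSum_coeff]
  refine Finset.sum_congr rfl fun m _ => ?_
  by_cases h : sideHom l (intVec m) = s
  · simp [h, Polynomial.coeff_monomial]
  · simp [h]

lemma exists_of_coeff_typeSubst_ne_zero {l : Fin (n + 1) → ℤ} {f : MvPolynomial (Fin (n + 1)) A}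
    {s : Fin n → ℤ} {k : ℕ} (h : ((typeSubst l f).coeff s).coeff k ≠ 0) :
    ∃ m ∈ f.support, sideHom l (intVec m) = s ∧ m (Fin.last n) = k := by
  rw [coeff_typeSubst_apply] at h
  obtain ⟨m, hm, h⟩ := Finset.exists_ne_zero_of_sum_ne_zero h
  exact ⟨m, hm, by_contra fun h' => h (if_neg h')⟩

lemma eq_of_sideHom_eq {l a b : Fin (n + 1) → ℤ} (hl : l (Fin.last n) ≠ 0)
    (h : sideHom l a = sideHom l b) (h' : a (Fin.last n) = b (Fin.last n)) : a = b := by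
  ext i
  refine Fin.lastCases h' (fun j => ?_) i
  have := congrFun h j
  rw [sideHom_apply, sideHom_apply, h'] at this
  exact mul_left_cancel₀ hl (by linarith)

/-- Exponents with equal image under `sideHom l` and equal last coordinate coincide, so no two
monomials of `f` collide. -/
lemma coeff_typeSubst {l : Fin (n + 1) → ℤ} (hl : l (Fin.last n) ≠ 0)
    (f : MvPolynomial (Fin (n + 1)) A) (m : Fin (n + 1) →₀ ℕ) :
    ((typeSubst l f).coeff (sideHom l (intVec m))).coeff (m (Fin.last n)) = f.coeff m := by
  classical
  rw [coeff_typeSubst_apply]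
  have : ∀ m', (sideHom l (intVec m') = sideHom l (intVec m) ∧ m' (Fin.last n) = m (Fin.last n)) ↔
      m' = m := by
    intro m'
    refine ⟨fun h => intVec_injective (eq_of_sideHom_eq hl h.1 ?_), by rintro rfl; simp⟩
    simp [intVec, h.2]
  simp only [this, Finset.sum_ite_eq', MvPolynomial.mem_support_iff, ne_eq, ite_not]
  split_ifs with h <;> simp [h]

/-- The exponents after the substitution attached to `l`. -/
def typeHom (l : Fin (n + 1) → ℤ) : (Fin (n + 1) → ℤ) →+ (Fin (n + 1) → ℤ) :=
  AddMonoidHom.mk' (fun a => Fin.snoc (α := fun _ => ℤ) (sideHom l a) (a (Fin.last n)))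
    fun a b => by
      ext i; refine Fin.lastCases ?_ (fun j => ?_) i <;> simp

lemma typeHom_last (l a : Fin (n + 1) → ℤ) : typeHom l a (Fin.last n) = a (Fin.last n) := by
  simp [typeHom]

lemma typeHom_castSucc (l a : Fin (n + 1) → ℤ) (j : Fin n) :
    typeHom l a j.castSucc = sideHom l a j := by
  simp [typeHom]

lemma typeHom_injective {l : Fin (n + 1) → ℤ} (hl : l (Fin.last n) ≠ 0) :
    Function.Injective (typeHom l) := fun a b h => by
  refine eq_of_sideHom_eq hl ?_ ?_
  · ext j; rw [← typeHom_castSucc, h, typeHom_castSucc]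
  · rw [← typeHom_last l a, h, typeHom_last]

/-- Laurent polynomials in `x_1, …, x_{n-1}` over `A[y]` as Laurent polynomials in
`x_1, …, x_{n-1}, y`. -/
def flattenLaurent : Laurent (Polynomial A) n →+* Laurent A (n + 1) :=
  AddMonoidAlgebra.liftNCRingHom
    (Polynomial.aeval (mono A (Pi.single (Fin.last n) (1 : ℤ)))).toRingHom
    { toFun := fun s => mono A (Fin.snoc (α := fun _ => ℤ) (Multiplicative.toAdd s) 0)
      map_one' := by
        rw [toAdd_one, ← mono_zero]; congr 1
        ext i; refine Fin.lastCases ?_ (fun j => ?_) i <;> simp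
      map_mul' := fun s t => by
        rw [toAdd_mul, ← mono_add]; congr 1
        ext i; refine Fin.lastCases ?_ (fun j => ?_) i <;> simp }
    fun _ _ => Commute.all _ _

lemma flattenLaurent_smul_mono (P : Polynomial A) (s : Fin n → ℤ) :
    flattenLaurent (P • mono (Polynomial A) s) =
      Polynomial.aeval (mono A (Pi.single (Fin.last n) (1 : ℤ))) P *
        mono A (Fin.snoc (α := fun _ => ℤ) s 0) := by
  rw [mono, AddMonoidAlgebra.smul_single, smul_eq_mul, mul_one, flattenLaurent,
    AddMonoidAlgebra.liftNCRingHom_single]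
  rfl

/-- Exhibits the substitution as an injective change of exponents, so that divisibility after it can
be pulled back by `dvd_of_mapDomain_dvd`. -/
lemma flattenLaurent_typeSubst (l : Fin (n + 1) → ℤ) (f : MvPolynomial (Fin (n + 1)) A) :
    flattenLaurent (typeSubst l f) =
      AddMonoidAlgebra.mapDomainAlgHom A A (typeHom l) (toLaurent f) := by
  rw [typeSubst_eq_sum, toLaurent_eq_sum, map_sum, map_sum]
  refine Finset.sum_congr rfl fun m _ => ?_
  have e : m (Fin.last n) • (Pi.single (Fin.last n) (1 : ℤ) : Fin (n + 1) → ℤ) +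
      Fin.snoc (α := fun _ => ℤ) (sideHom l (intVec m)) 0 = typeHom l (intVec m) := by
    ext i
    refine Fin.lastCases ?_ (fun j => ?_) i
    · simp [typeHom, intVec]
    · simp [typeHom]
  rw [flattenLaurent_smul_mono, Polynomial.aeval_monomial, mono_pow, mul_assoc, ← mono_add, e,
    map_smul, Algebra.smul_def]
  simp [mono]

/-! ### The content attached to a type -/

/-- Passing to the numerator only shifts exponents, so the nonzero coefficients, and with them the
common divisors, stay the same. -/
lemma isTypeContent_iff {l : Fin (n + 1) → ℤ} {f : MvPolynomial (Fin (n + 1)) A}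
    {P : Polynomial A} :
    IsTypeContent l f P ↔ IsGCDOf (Set.range fun s => (typeSubst l f).coeff s) P := by
  have key : ∀ (h : MvPolynomial (Fin n) (Polynomial A)) (b : Fin n → ℕ),
      IsNumDen (typeSubst l f) h b → ∀ d : Polynomial A,
      (∀ a ∈ Set.range fun m => h.coeff m, d ∣ a) ↔
        ∀ a ∈ Set.range fun s => (typeSubst l f).coeff s, d ∣ a := by
    intro h b hh d
    constructor
    · rintro H _ ⟨s, rfl⟩
      by_cases h0 : (typeSubst l f).coeff s = 0
      · simp [h0]
      have h1 : (toLaurent h).coeff (s + fun i => (b i : ℤ)) = (typeSubst l f).coeff s := by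
        rw [hh.1, coeff_mono_mul, add_sub_cancel_right]
      obtain ⟨m, -, e⟩ := exists_of_coeff_toLaurent_ne_zero (h1 ▸ h0)
      change d ∣ (typeSubst l f).coeff s
      rw [← h1, ← e, coeff_toLaurent]
      exact H _ ⟨m, rfl⟩
    · rintro H _ ⟨m, rfl⟩
      change d ∣ h.coeff m
      rw [← coeff_toLaurent, hh.1, coeff_mono_mul]
      exact H _ ⟨_, rfl⟩
  constructor
  · rintro ⟨h, b, hh, hP⟩
    exact ⟨(key h b hh P).1 hP.1, fun d hd => hP.2 d ((key h b hh d).2 hd)⟩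
  · intro hP
    obtain ⟨h, b, hh⟩ := exists_isNumDen (typeSubst l f)
    exact ⟨h, b, hh, (key h b hh P).2 hP.1, fun d hd => hP.2 d ((key h b hh d).1 hd)⟩

lemma exists_isTypeContent [IsDomain A] [UniqueFactorizationMonoid A] (l : Fin (n + 1) → ℤ)
    (f : MvPolynomial (Fin (n + 1)) A) : ∃ P, IsTypeContent l f P := by
  obtain ⟨h, b, hh⟩ := exists_isNumDen (typeSubst l f)
  obtain ⟨P, hP⟩ := exists_isContent h
  exact ⟨P, h, b, hh, hP⟩

/-- Every monomial of `f` survives with its exponent of `x_n` as exponent of `y`; if `y` divided all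
coefficients, `x_n` would divide `f`. -/
lemma IsTypeContent.coeff_zero_ne_zero {l : Fin (n + 1) → ℤ} (hl : l (Fin.last n) ≠ 0)
    {f : MvPolynomial (Fin (n + 1)) A} {P : Polynomial A} (hP : IsTypeContent l f P)
    (hX : ¬ MvPolynomial.X (Fin.last n) ∣ f) : P.coeff 0 ≠ 0 := by
  intro h0
  refine hX (X_dvd_iff_support.2 fun m hm hm0 => ?_)
  have h1 : Polynomial.X ∣ (typeSubst l f).coeff (sideHom l (intVec m)) :=
    (Polynomial.X_dvd_iff.2 h0).trans ((isTypeContent_iff.1 hP).1 _ ⟨_, rfl⟩)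
  rw [Polynomial.X_dvd_iff, ← hm0, coeff_typeSubst hl] at h1
  exact MvPolynomial.mem_support_iff.1 hm h1

/-- `l_n` divides the product of the difference with each `l_i`, and the `l_i` have gcd 1. -/
lemma dvd_sub_of_sideHom_eq {l a b : Fin (n + 1) → ℤ} (hl : Finset.univ.gcd l = 1)
    (h : sideHom l a = sideHom l b) : l (Fin.last n) ∣ a (Fin.last n) - b (Fin.last n) := by
  have h1 : ∀ i ∈ (Finset.univ : Finset (Fin (n + 1))),
      l (Fin.last n) ∣ (a (Fin.last n) - b (Fin.last n)) * l i := by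
    intro i _
    refine Fin.lastCases (Dvd.intro_left _ rfl) (fun j => ?_) i
    have := congrFun h j
    rw [sideHom_apply, sideHom_apply] at this
    exact ⟨a j.castSucc - b j.castSucc, by linarith⟩
  have h2 := Finset.dvd_gcd h1
  rw [Finset.gcd_mul_left, hl, mul_one] at h2
  exact (dvd_normalize_iff).1 h2

variable [IsDomain A] [UniqueFactorizationMonoid A]

/-- This gives a meaning to `P(y^{1/l_n})` in step 8: within one coefficient the exponents of `y`
are congruent modulo `l_n`. -/
lemma IsTypeContent.exists_eq_expand {l : Fin (n + 1) → ℤ} (hl : Finset.univ.gcd l = 1)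
    (hpos : 0 < l (Fin.last n)) {f : MvPolynomial (Fin (n + 1)) A} {P : Polynomial A}
    (hP : IsTypeContent l f P) (hX : ¬ MvPolynomial.X (Fin.last n) ∣ f) :
    ∃ Q, P = Polynomial.expand A (l (Fin.last n)).toNat Q := by
  refine exists_eq_expand_of_isGCDOf (by omega) (fun s => ?_) (isTypeContent_iff.1 hP)
    (hP.coeff_zero_ne_zero hpos.ne' hX)
  refine exists_eq_X_pow_mul_expand (by omega) fun k k' hk hk' => ?_
  obtain ⟨m, -, hs, rfl⟩ := exists_of_coeff_typeSubst_ne_zero hk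
  obtain ⟨m', -, hs', rfl⟩ := exists_of_coeff_typeSubst_ne_zero hk'
  rw [Int.toNat_of_nonneg hpos.le]
  exact dvd_sub_of_sideHom_eq hl (hs.trans hs'.symm)

lemma expand_coeff_zero {N : ℕ} (hN : 0 < N) (Q : Polynomial A) :
    (Polynomial.expand A N Q).coeff 0 = Q.coeff 0 := by
  simpa using Polynomial.coeff_expand_mul hN Q 0

lemma IsTypeContent.isQPrimitive {l : Fin (n + 1) → ℤ} (hpos : 0 < l (Fin.last n))
    {f : MvPolynomial (Fin (n + 1)) A} {Q : Polynomial A}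
    (hP : IsTypeContent l f (Polynomial.expand A (l (Fin.last n)).toNat Q))
    (hX : ¬ MvPolynomial.X (Fin.last n) ∣ f) (hf : PrimC f) : IsQPrimitive Q := by
  have hN : 0 < (l (Fin.last n)).toNat := by omega
  refine ⟨fun r hr => hf r ?_, ?_⟩
  · rw [MvPolynomial.C_dvd_iff_dvd_coeff]
    intro m
    have h1 : Polynomial.C r ∣ (typeSubst l f).coeff (sideHom l (intVec m)) := by
      refine dvd_trans ?_ ((isTypeContent_iff.1 hP).1 _ ⟨_, rfl⟩)
      have := map_dvd (Polynomial.expand A (l (Fin.last n)).toNat) hr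
      rwa [Polynomial.expand_C] at this
    rw [← coeff_typeSubst hpos.ne' f m]
    exact (Polynomial.C_dvd_iff_dvd_coeff _ _).1 h1 _
  · rw [← expand_coeff_zero hN]
    exact hP.coeff_zero_ne_zero hpos.ne' hX

/-- If the content attached to `l` is `Q(y^{l_n})`, then `Q(x^l)` divides the polynomial. -/
lemma IsTypeContent.substMono_dvd {l : Fin (n + 1) → ℤ} (hpos : 0 < l (Fin.last n))
    {f : MvPolynomial (Fin (n + 1)) A} {Q : Polynomial A}
    (hP : IsTypeContent l f (Polynomial.expand A (l (Fin.last n)).toNat Q)) :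
    substMono Q l ∣ toLaurent f := by
  apply dvd_of_mapDomain_dvd (typeHom l) (typeHom_injective hpos.ne')
  rw [← flattenLaurent_typeSubst]
  -- The direction `l` has side exponent `0`, so `x^l` becomes `y^{l_n}` and `Q(x^l)` becomes the
  -- content itself.
  have h1 : AddMonoidAlgebra.mapDomainAlgHom A A (typeHom l) (substMono Q l) =
      flattenLaurent (Polynomial.expand A (l (Fin.last n)).toNat Q •
        mono (Polynomial A) (0 : Fin n → ℤ)) := by
    have e0 : (Fin.snoc (α := fun _ => ℤ) (0 : Fin n → ℤ) 0 : Fin (n + 1) → ℤ) = 0 := by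
      ext i; refine Fin.lastCases ?_ (fun j => ?_) i <;> simp
    have e1 : (l (Fin.last n)).toNat • (Pi.single (Fin.last n) (1 : ℤ) : Fin (n + 1) → ℤ) =
        typeHom l l := by
      ext i
      refine Fin.lastCases ?_ (fun j => ?_) i
      · simp [typeHom]; omega
      · simp [typeHom, sideHom_self]
    rw [flattenLaurent_smul_mono, e0, mono_zero, mul_one, Polynomial.expand_aeval, mono_pow, e1,
      substMono, ← Polynomial.aeval_algHom_apply]
    simp [mono]
  rw [h1]
  refine map_dvd _ ?_
  have hd : ∀ s, Polynomial.expand A (l (Fin.last n)).toNat Q ∣ (typeSubst l f).coeff s :=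
    fun s => (isTypeContent_iff.1 hP).1 _ ⟨s, rfl⟩
  choose w hw using hd
  classical
  -- The content divides each coefficient, and the quotients are the coefficients of the cofactor.
  refine ⟨∑ s ∈ (typeSubst l f).coeff.support, AddMonoidAlgebra.single s (w s), ?_⟩
  rw [smul_mul_assoc, mono_zero, one_mul, Finset.smul_sum]
  conv_lhs => rw [← AddMonoidAlgebra.sum_coeff_single (typeSubst l f), Finsupp.sum]
  refine Finset.sum_congr rfl fun s _ => ?_
  rw [AddMonoidAlgebra.smul_single, smul_eq_mul, ← hw]

/-- `Q(0) ≠ 0` makes the numerator prime to all variables, so divisibility descends from Laurent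
polynomials. -/
lemma IsTypeContent.numerator_dvd {l : Fin (n + 1) → ℤ} (hpos : 0 < l (Fin.last n))
    {f h : MvPolynomial (Fin (n + 1)) A} {Q : Polynomial A} {b : Fin (n + 1) → ℕ}
    (hP : IsTypeContent l f (Polynomial.expand A (l (Fin.last n)).toNat Q))
    (hX : ¬ MvPolynomial.X (Fin.last n) ∣ f) (hh : IsNumDen (substMono Q l) h b) : h ∣ f := by
  have hl0 : l ≠ 0 := fun h => hpos.ne' (by rw [h]; rfl)
  have hQ0 : Q.coeff 0 ≠ 0 := by
    rw [← expand_coeff_zero (N := (l (Fin.last n)).toNat) (by omega)]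
    exact hP.coeff_zero_ne_zero hpos.ne' hX
  refine dvd_of_toLaurent_dvd (hh.not_X_dvd hl0 hQ0) ?_
  rw [hh.1]
  exact ((isUnit_mono _).mul_left_dvd).2 (hP.substMono_dvd hpos)

/-! ### Aligned factors -/

/-- `sideHom l` is constant on a line with direction `l`, so only one monomial in `x_1, …, x_{n-1}`
occurs. -/
lemma Aligned.exists_typeSubst_eq {l : Fin (n + 1) → ℤ} {u : MvPolynomial (Fin (n + 1)) A}
    (hu : Aligned l u) : ∃ (s : Fin n → ℤ) (F : Polynomial A),
      typeSubst l u = AddMonoidAlgebra.single s F := by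
  obtain ⟨a, ha⟩ := hu
  refine ⟨sideHom l a, (typeSubst l u).coeff (sideHom l a), ?_⟩
  ext s k
  classical
  rw [AddMonoidAlgebra.coeff_single, Finsupp.single_apply]
  split_ifs with h
  · rw [h]
  · by_contra hne
    rw [Polynomial.coeff_zero] at hne
    obtain ⟨m, hm, hs, -⟩ := exists_of_coeff_typeSubst_ne_zero hne
    obtain ⟨k, hk⟩ := ha m hm
    refine h ?_
    rw [← hs, hk, map_add, map_zsmul, sideHom_self, smul_zero, add_zero]

lemma coeff_of_typeSubst_eq {l : Fin (n + 1) → ℤ} (hl : l (Fin.last n) ≠ 0)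
    {u : MvPolynomial (Fin (n + 1)) A} {s : Fin n → ℤ} {F : Polynomial A}
    (h : typeSubst l u = AddMonoidAlgebra.single s F) {m : Fin (n + 1) →₀ ℕ} (hm : m ∈ u.support) :
    F.coeff (m (Fin.last n)) = u.coeff m := by
  classical
  have h1 := coeff_typeSubst hl u m
  rw [h, AddMonoidAlgebra.coeff_single, Finsupp.single_apply] at h1
  split_ifs at h1 with hs
  · exact h1
  · exact absurd h1.symm (MvPolynomial.mem_support_iff.1 hm)

lemma Aligned.last_ne {l : Fin (n + 1) → ℤ} (hl : l (Fin.last n) ≠ 0)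
    {u : MvPolynomial (Fin (n + 1)) A} (hu : Aligned l u) {m m' : Fin (n + 1) →₀ ℕ}
    (hm : m ∈ u.support) (hm' : m' ∈ u.support) (hne : m ≠ m') :
    m (Fin.last n) ≠ m' (Fin.last n) := by
  intro h
  obtain ⟨a, ha⟩ := hu
  obtain ⟨k, hk⟩ := ha m hm
  obtain ⟨k', hk'⟩ := ha m' hm'
  refine hne (intVec_injective (eq_of_sideHom_eq hl ?_ (by simp [intVec, h])))
  rw [hk, hk', map_add, map_add, map_zsmul, map_zsmul, sideHom_self, smul_zero, smul_zero]

/-- The factor `u` turns into `F` times a Laurent monomial, so `F` divides all coefficients of the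
product. -/
lemma IsTypeContent.mul_dvd {l : Fin (n + 1) → ℤ} {f u g : MvPolynomial (Fin (n + 1)) A}
    {P F : Polynomial A} {s : Fin n → ℤ} (hP : IsTypeContent l f P) (hf : f = u * g)
    (hu : typeSubst l u = AddMonoidAlgebra.single s F) : F ∣ P := by
  refine (isTypeContent_iff.1 hP).2 F ?_
  rintro _ ⟨t, rfl⟩
  simp only [hf, typeSubst_mul, hu, AddMonoidAlgebra.coeff_single_mul_apply]
  exact Dvd.intro _ rfl

/-- A polynomial whose content attached to `l` has degree zero has no factor with at least two
terms aligned with `l`. -/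
lemma IsTypeContent.natDegree_pos {l : Fin (n + 1) → ℤ} (hl : l (Fin.last n) ≠ 0)
    {f u : MvPolynomial (Fin (n + 1)) A} {P : Polynomial A} (hP : IsTypeContent l f P)
    (hP0 : P ≠ 0) (hd : u ∣ f) (hu : Aligned l u) {m m' : Fin (n + 1) →₀ ℕ}
    (hm : m ∈ u.support) (hm' : m' ∈ u.support) (hne : m ≠ m') : 0 < P.natDegree := by
  obtain ⟨s, F, hF⟩ := hu.exists_typeSubst_eq
  obtain ⟨g, hg⟩ := hd
  have h1 := Polynomial.natDegree_le_of_dvd (hP.mul_dvd hg hF) hP0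
  have h2 : F.coeff (m (Fin.last n)) ≠ 0 := by
    rw [coeff_of_typeSubst_eq hl hF hm]; exact MvPolynomial.mem_support_iff.1 hm
  have h3 : F.coeff (m' (Fin.last n)) ≠ 0 := by
    rw [coeff_of_typeSubst_eq hl hF hm']; exact MvPolynomial.mem_support_iff.1 hm'
  have := Polynomial.le_natDegree_of_ne_zero h2
  have := Polynomial.le_natDegree_of_ne_zero h3
  have := hu.last_ne hl hm hm' hne
  omega

/-- Dividing by the numerator of `Q(x^l)` removes all factors aligned with `l`. -/
lemma IsTypeContent.not_aligned_of_eq_mul {l : Fin (n + 1) → ℤ} (hpos : 0 < l (Fin.last n))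
    {f f' h u : MvPolynomial (Fin (n + 1)) A} {Q : Polynomial A} {b : Fin (n + 1) → ℕ}
    (hP : IsTypeContent l f (Polynomial.expand A (l (Fin.last n)).toNat Q)) (hQ : Q ≠ 0)
    (hh : IsNumDen (substMono Q l) h b) (hf : f = f' * h) (hd : u ∣ f') {m m' : Fin (n + 1) →₀ ℕ}
    (hm : m ∈ u.support) (hm' : m' ∈ u.support) (hne : m ≠ m') : ¬ Aligned l u := by
  intro hu
  have hl0 : l ≠ 0 := fun h => hpos.ne' (by rw [h]; rfl)
  have hN : 0 < (l (Fin.last n)).toNat := by omega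
  have hha : Aligned l h := ⟨_, fun m hm => by
    obtain ⟨k, -, hk⟩ := hh.exists_of_mem_support hm
    exact ⟨k, by rw [hk, natCast_zsmul]⟩⟩
  obtain ⟨s, F, hF⟩ := hu.exists_typeSubst_eq
  obtain ⟨t, H, hH⟩ := hha.exists_typeSubst_eq
  obtain ⟨g, rfl⟩ := hd
  have hP0 : Polynomial.expand A (l (Fin.last n)).toNat Q ≠ 0 := (Polynomial.expand_ne_zero hN).2 hQ
  -- `u * h` divides `f` and is aligned too. But `H` already has at least the degree of the content,
  -- and `F`, having two terms, has positive degree.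
  have hdvd : F * H ∣ Polynomial.expand A (l (Fin.last n)).toNat Q :=
    hP.mul_dvd (u := u * h) (g := g) (s := s + t) (by rw [hf]; ring)
      (by rw [typeSubst_mul, hF, hH, AddMonoidAlgebra.single_mul_single])
  have h2 : F.coeff (m (Fin.last n)) ≠ 0 := by
    rw [coeff_of_typeSubst_eq hpos.ne' hF hm]; exact MvPolynomial.mem_support_iff.1 hm
  have h3 : F.coeff (m' (Fin.last n)) ≠ 0 := by
    rw [coeff_of_typeSubst_eq hpos.ne' hF hm']; exact MvPolynomial.mem_support_iff.1 hm'
  obtain ⟨w, hw, ew⟩ := hh.exists_mem_support hl0 (k := Q.natDegree)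
    (by rwa [← Polynomial.leadingCoeff, Polynomial.leadingCoeff_ne_zero])
  have h4 : H.coeff (w (Fin.last n)) ≠ 0 := by
    rw [coeff_of_typeSubst_eq hpos.ne' hH hw]; exact MvPolynomial.mem_support_iff.1 hw
  have h5 : Q.natDegree * (l (Fin.last n)).toNat ≤ w (Fin.last n) := by
    have := congrFun ew (Fin.last n)
    simp only [intVec, Pi.add_apply, nsmul_eq_mul, Pi.mul_apply, Pi.natCast_apply] at this
    zify
    rw [this, Int.toNat_of_nonneg hpos.le]
    omega
  have hF0 : F ≠ 0 := by rintro rfl; simp at h2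
  have hH0 : H ≠ 0 := by rintro rfl; simp at h4
  have h6 := Polynomial.natDegree_le_of_dvd hdvd hP0
  rw [Polynomial.natDegree_mul hF0 hH0, Polynomial.natDegree_expand] at h6
  have := Polynomial.le_natDegree_of_ne_zero h2
  have := Polynomial.le_natDegree_of_ne_zero h3
  have := Polynomial.le_natDegree_of_ne_zero h4
  have := hu.last_ne hpos.ne' hm hm' hne
  omega

/-- If `f` has a factor with at least two terms aligned with `l`, then every line with direction `l`
that meets the support of `f` meets it at least twice. -/
lemma exists_mem_support_sideHom_eq {l : Fin (n + 1) → ℤ} (hl : l (Fin.last n) ≠ 0)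
    {f u : MvPolynomial (Fin (n + 1)) A} (hd : u ∣ f) (hu : Aligned l u)
    {m m' : Fin (n + 1) →₀ ℕ} (hm : m ∈ u.support) (hm' : m' ∈ u.support) (hne : m ≠ m')
    {v : Fin (n + 1) →₀ ℕ} (hv : v ∈ f.support) :
    ∃ w ∈ f.support, w ≠ v ∧ sideHom l (intVec w) = sideHom l (intVec v) := by
  obtain ⟨s, F, hF⟩ := hu.exists_typeSubst_eq
  obtain ⟨g, rfl⟩ := hd
  have h2 : F.coeff (m (Fin.last n)) ≠ 0 := by
    rw [coeff_of_typeSubst_eq hl hF hm]; exact MvPolynomial.mem_support_iff.1 hm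
  have h3 : F.coeff (m' (Fin.last n)) ≠ 0 := by
    rw [coeff_of_typeSubst_eq hl hF hm']; exact MvPolynomial.mem_support_iff.1 hm'
  -- The points of the support on the line through `v` form one coefficient after the substitution,
  -- and this coefficient is a multiple of `F`, which has two terms.
  have h4 : (typeSubst l (u * g)).coeff (sideHom l (intVec v)) =
      F * (typeSubst l g).coeff (-s + sideHom l (intVec v)) := by
    rw [typeSubst_mul, hF, AddMonoidAlgebra.coeff_single_mul_apply]
  have h5 : (typeSubst l g).coeff (-s + sideHom l (intVec v)) ≠ 0 := by
    intro h0
    have := coeff_typeSubst hl (u * g) v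
    rw [h4, h0, mul_zero, Polynomial.coeff_zero] at this
    exact MvPolynomial.mem_support_iff.1 hv this.symm
  obtain ⟨k, hk, h6⟩ := exists_coeff_mul_ne_zero (hu.last_ne hl hm hm' hne) h2 h3 h5
    (v (Fin.last n))
  rw [← h4] at h6
  obtain ⟨w, hw, e, rfl⟩ := exists_of_coeff_typeSubst_ne_zero h6
  exact ⟨w, hw, by rintro rfl; exact hk rfl, e⟩

end TypeSubst

/-! ### Normalized vectors -/

section Normalized

variable {n : ℕ}

lemma IsNormalizedVec.ne_zero {l : Fin n → ℤ} (h : IsNormalizedVec l) : l ≠ 0 := by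
  obtain ⟨-, k, hk, -⟩ := h
  rintro rfl
  exact hk.ne rfl

lemma IsNormalizedVec.last_pos {l : Fin (n + 1) → ℤ} (h : IsNormalizedVec l)
    (h0 : l (Fin.last n) ≠ 0) : 0 < l (Fin.last n) := by
  obtain ⟨-, k, hk, hj⟩ := h
  rcases (Fin.le_last k).eq_or_lt with e | e
  · rwa [← e]
  · exact absurd (hj _ e) h0

/-- Taking the gcd over `i` of `l i * l' j = l j * l' i` gives `|l' j| = |l j|`; the rightmost
nonzero coordinate fixes the common sign. -/
lemma IsNormalizedVec.eq_of_parallel {l l' : Fin n → ℤ} (h : IsNormalizedVec l)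
    (h' : IsNormalizedVec l') (hp : ∀ i j, l i * l' j = l j * l' i) : l = l' := by
  have habs : ∀ j, normalize (l' j) = normalize (l j) := by
    intro j
    have e : (Finset.univ.gcd fun i => l i * l' j) = Finset.univ.gcd fun i => l j * l' i :=
      Finset.gcd_congr rfl fun i _ => hp i j
    have h1 := h.1
    have h2 := h'.1
    rwa [Finset.gcd_mul_right, Finset.gcd_mul_left, h1, h2, one_mul, mul_one] at e
  obtain ⟨-, k, hk, hk0⟩ := h
  obtain ⟨-, k', hk', hk0'⟩ := h'
  have hz : ∀ j, l j = 0 ↔ l' j = 0 := fun j => by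
    rw [← normalize_eq_zero, ← habs j, normalize_eq_zero]
  have hkk : k = k' := by
    rcases lt_trichotomy k k' with hlt | heq | hgt
    · exact absurd ((hz _).1 (hk0 _ hlt)) hk'.ne'
    · exact heq
    · exact absurd ((hz _).2 (hk0' _ hgt)) hk.ne'
  subst hkk
  have e : l k = l' k := by
    have := habs k
    rwa [Int.normalize_of_nonneg hk.le, Int.normalize_of_nonneg hk'.le, eq_comm] at this
  ext i
  have := hp i k
  rw [← e, mul_comm (l k)] at this
  exact mul_right_cancel₀ hk.ne' this

lemma IsNormalizedVec.eq_of_real_parallel {l l' : Fin n → ℤ} (h : IsNormalizedVec l)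
    (h' : IsNormalizedVec l') {t t' : ℝ} (ht : t ≠ 0)
    (e : t • (fun i => (l i : ℝ)) = t' • (fun i => (l' i : ℝ))) : l = l' := by
  refine h.eq_of_parallel h' fun i j => ?_
  have hi := congrFun e i
  have hj := congrFun e j
  simp only [Pi.smul_apply, smul_eq_mul] at hi hj
  have : (l i : ℝ) * l' j = l j * l' i := by
    apply mul_left_cancel₀ ht
    calc t * (l i * l' j) = (t * l i) * l' j := by ring
      _ = (t' * l' j) * l' i := by rw [hi]; ring
      _ = t * (l j * l' i) := by rw [← hj]; ring
  exact_mod_cast this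

lemma IsDirection.eq_of_segment_eq {u v u' v' : Fin n → ℝ} {l l' : Fin n → ℤ}
    (h : IsDirection u v l) (h' : IsDirection u' v' l') (e : segment ℝ u v = segment ℝ u' v') :
    l = l' := by
  obtain ⟨-, hl, t, ht⟩ := h
  obtain ⟨hne', hl', t', ht'⟩ := h'
  have hu : u' ∈ segment ℝ u v := e ▸ left_mem_segment ℝ u' v'
  have hv : v' ∈ segment ℝ u v := e ▸ right_mem_segment ℝ u' v'
  rw [segment_eq_image'] at hu hv
  obtain ⟨a, -, rfl⟩ := hu
  obtain ⟨b, -, rfl⟩ := hv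
  refine (hl'.eq_of_real_parallel hl (t := t') (t' := (b - a) * t) ?_ ?_).symm
  · rintro rfl
    rw [zero_smul, sub_eq_zero] at ht'
    exact hne' ht'
  · rw [← ht', mul_smul, ← ht]
    module

end Normalized

/-! ### Faces of Newton polytopes -/

section Faces

variable {V : Type*} [AddCommGroup V] [Module ℝ V] [TopologicalSpace V]

/-- The face of the convex hull of a finite set exposed by a linear functional is the convex hull
of the points of the set at which the functional is maximal. -/
lemma toExposed_convexHull {S : Set V} (hS : S.Finite) (g : V →L[ℝ] ℝ) :
    {x ∈ convexHull ℝ S | ∀ y ∈ convexHull ℝ S, g y ≤ g x} =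
      convexHull ℝ {x ∈ S | ∀ y ∈ S, g y ≤ g x} := by
  rcases S.eq_empty_or_nonempty with rfl | hne
  · simp
  obtain ⟨p, hp, hmax⟩ := Set.exists_max_image S g hS hne
  have hle : ∀ y ∈ convexHull ℝ S, g y ≤ g p := fun y hy =>
    convexHull_min (t := {y | g y ≤ g p}) hmax (convex_halfSpace_le g.isLinear _) hy
  set T := {x ∈ S | ∀ y ∈ S, g y ≤ g x}
  have hTg : ∀ x ∈ convexHull ℝ T, g x = g p := fun x hx =>
    convexHull_min (t := {y | g y = g p}) (fun y hy => le_antisymm (hmax y hy.1) (hy.2 p hp))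
      (convex_hyperplane g.isLinear _) hx
  have hTp : p ∈ T := ⟨hp, hmax⟩
  apply Set.Subset.antisymm
  · rintro x ⟨hx, hxm⟩
    have hxp : g x = g p := le_antisymm (hle x hx) (hxm p (subset_convexHull ℝ S hp))
    rcases (S \ T).eq_empty_or_nonempty with he | hne'
    · exact convexHull_mono (Set.sdiff_eq_empty.1 he) hx
    -- A point of the hull lies between a point of the hull of `T` and one of the hull of the rest,
    -- where `g` is strictly smaller; being maximal forces `θ = 0` or a contradiction.
    have hU : S = T ∪ (S \ T) := (Set.union_sdiff_cancel (Set.sep_subset _ _)).symm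
    rw [hU, convexHull_union ⟨p, hTp⟩ hne', mem_convexJoin] at hx
    obtain ⟨a, ha, b, hb, hx⟩ := hx
    have hbp : g b < g p := by
      refine convexHull_min (t := {y | g y < g p}) (fun y hy => ?_)
        (convex_halfSpace_lt g.isLinear _) hb
      refine lt_of_le_of_ne (hmax y hy.1) fun h => hy.2 ⟨hy.1, fun z hz => ?_⟩
      rw [h]; exact hmax z hz
    rw [segment_eq_image'] at hx
    obtain ⟨θ, -, rfl⟩ := hx
    have : θ * (g b - g p) = 0 := by
      have h1 := hxp
      simp only [map_add, map_smul, map_sub, hTg a ha, smul_eq_mul] at h1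
      linarith
    rcases mul_eq_zero.1 this with h | h
    · simpa [h] using ha
    · linarith
  · intro x hx
    exact ⟨convexHull_mono (Set.sep_subset _ _) hx, fun y hy => by rw [hTg x hx]; exact hle y hy⟩

lemma IsExposed.exists_eq {B : Set V} {S : Set V} (hS : S.Finite)
    (hB : IsExposed ℝ (convexHull ℝ S) B) (hne : B.Nonempty) : ∃ T ⊆ S, B = convexHull ℝ T := by
  obtain ⟨g, hg⟩ := hB hne
  exact ⟨_, Set.sep_subset _ _, hg.trans (toExposed_convexHull hS g)⟩

/-- A nonempty face is the hull of a subset of the finite set `S`. -/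
lemma finite_setOf_isExposed {S : Set V} (hS : S.Finite) :
    {B | IsExposed ℝ (convexHull ℝ S) B}.Finite := by
  refine ((hS.finite_subsets.image (convexHull ℝ)).insert ∅).subset fun B hB => ?_
  rcases B.eq_empty_or_nonempty with rfl | hne
  · exact Set.mem_insert _ _
  · obtain ⟨T, hT, rfl⟩ := IsExposed.exists_eq hS hB hne
    exact Set.mem_insert_of_mem _ ⟨T, hT, rfl⟩

end Faces

/-! ### Finiteness of the edges of a Newton polytope -/

section Newt

variable {A : Type*} [CommRing A] {n : ℕ}

lemma finite_expPoint (f : MvPolynomial (Fin n) A) :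
    (expPoint '' (f.support : Set (Fin n →₀ ℕ))).Finite := f.support.finite_toSet.image _

lemma finite_edgesOfDirection (f : MvPolynomial (Fin n) A) (l : Fin n → ℤ) :
    (edgesOfDirection f l).Finite :=
  (finite_setOf_isExposed (finite_expPoint f)).subset fun _ h => h.1

/-- An edge determines its direction, so choosing one edge per direction is an injection into the
finite set of faces. -/
lemma finite_edge_directions (f : MvPolynomial (Fin n) A) :
    {l | (edgesOfDirection f l).Nonempty}.Finite := by
  have h : ∀ l ∈ {l | (edgesOfDirection f l).Nonempty}, ∃ F, F ∈ edgesOfDirection f l :=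
    fun _ h => h
  choose! F hF using h
  refine Set.Finite.of_finite_image (f := F) ((finite_setOf_isExposed (finite_expPoint f)).subset
    ?_) (fun l hl l' hl' e => ?_)
  · rintro _ ⟨l, hl, rfl⟩
    exact (hF l hl).1
  · obtain ⟨-, u, v, e₁, h₁⟩ := hF l hl
    obtain ⟨-, u', v', e₂, h₂⟩ := hF l' hl'
    exact h₁.eq_of_segment_eq h₂ (by rw [← e₁, ← e₂, e])

lemma exists_isEdgeDirections (f : MvPolynomial (Fin n) A) : ∃ Λ, IsEdgeDirections f Λ := by
  classical
  refine ⟨∑ l ∈ (finite_edge_directions f).toFinset with ∀ i, l i ≠ 0,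
    (edgesOfDirection f l).ncard • {l}, fun l => ?_⟩
  have key : Multiset.count l (∑ l ∈ (finite_edge_directions f).toFinset with ∀ i, l i ≠ 0,
      (edgesOfDirection f l).ncard • {l}) =
      if ∀ i, l i ≠ 0 then (edgesOfDirection f l).ncard else 0 := by
    rw [Multiset.count_sum']
    simp only [Multiset.count_nsmul, Multiset.count_singleton, mul_ite, mul_one, mul_zero,
      Finset.sum_ite_eq, Finset.mem_filter, Set.Finite.mem_toFinset, Set.mem_ofPred_eq]
    by_cases hne : (edgesOfDirection f l).Nonempty
    · simp [hne]
    · simp [Set.not_nonempty_iff_eq_empty.1 hne]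
  rw [key]
  refine ⟨fun h => ?_, fun h => ?_⟩
  · rw [if_pos h, (finite_edgesOfDirection f l).cast_ncard_eq]
  · rw [if_neg (by simpa using h)]

end Newt

/-! ### Edges parallel to a type -/

section Edges

variable {A : Type*} [CommRing A] {n : ℕ}

/-- The real linear map extending `sideHom`; its kernel is the line with direction `l`. -/
def sideLin (l : Fin (n + 1) → ℤ) : (Fin (n + 1) → ℝ) →ₗ[ℝ] (Fin n → ℝ) where
  toFun x j := l (Fin.last n) * x j.castSucc - x (Fin.last n) * l j.castSucc
  map_add' x y := by ext j; simp; ring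
  map_smul' c x := by ext j; simp; ring

lemma sideLin_apply (l : Fin (n + 1) → ℤ) (x : Fin (n + 1) → ℝ) (j : Fin n) :
    sideLin l x j = l (Fin.last n) * x j.castSucc - x (Fin.last n) * l j.castSucc := rfl

lemma sideLin_expPoint (l : Fin (n + 1) → ℤ) (m : Fin (n + 1) →₀ ℕ) (j : Fin n) :
    sideLin l (expPoint m) j = (sideHom l (intVec m) j : ℝ) := by
  simp [sideLin_apply, sideHom_apply, expPoint, intVec]

lemma sideLin_expPoint_eq_iff (l : Fin (n + 1) → ℤ) (m m' : Fin (n + 1) →₀ ℕ) :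
    sideLin l (expPoint m) = sideLin l (expPoint m') ↔
      sideHom l (intVec m) = sideHom l (intVec m') := by
  simp only [funext_iff, sideLin_expPoint, Int.cast_inj]

lemma sub_eq_of_sideLin_eq {l : Fin (n + 1) → ℤ} (hl : l (Fin.last n) ≠ 0)
    {x y : Fin (n + 1) → ℝ} (h : sideLin l x = sideLin l y) :
    x - y = ((x (Fin.last n) - y (Fin.last n)) / l (Fin.last n)) • (fun i => (l i : ℝ)) := by
  have hl' : (l (Fin.last n) : ℝ) ≠ 0 := by exact_mod_cast hl
  ext i
  refine Fin.lastCases ?_ (fun j => ?_) i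
  · simp [hl']
  · have := congrFun h j
    rw [sideLin_apply, sideLin_apply] at this
    simp only [Pi.sub_apply, Pi.smul_apply, smul_eq_mul]
    field_simp
    linarith

lemma expPoint_injective : Function.Injective (expPoint (n := n)) := fun a b h => by
  ext i
  have := congrFun h i
  simpa [expPoint] using this

/-- A functional whose values on the support of `f` separate exactly the lines with
direction `l`. -/
lemma exists_separating_functional (l : Fin (n + 1) → ℤ) (f : MvPolynomial (Fin (n + 1)) A) :
    ∃ g : (Fin (n + 1) → ℝ) →L[ℝ] ℝ, ∀ v ∈ f.support, ∀ w ∈ f.support,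
      g (expPoint v) = g (expPoint w) ↔ sideHom l (intVec v) = sideHom l (intVec w) := by
  let ι := {p : f.support × f.support //
    sideHom l (intVec p.1.1) ≠ sideHom l (intVec p.2.1)}
  obtain ⟨φ, hφ⟩ := Module.exists_dual_forall_apply_ne_zero (K := ℝ)
    (fun p : ι => sideLin l (expPoint p.1.1.1) - sideLin l (expPoint p.1.2.1))
    (fun p h => p.2 ((sideLin_expPoint_eq_iff _ _ _).1 (sub_eq_zero.1 h)))
  refine ⟨LinearMap.toContinuousLinearMap (φ ∘ₗ sideLin l),
    fun v hv w hw => ⟨fun h => ?_, fun h => ?_⟩⟩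
  · by_contra hne
    refine hφ ⟨(⟨v, hv⟩, ⟨w, hw⟩), hne⟩ ?_
    simpa [sub_eq_zero] using h
  · simp [(sideLin_expPoint_eq_iff _ _ _).2 h]

/-- Every line with direction `l` that meets the support of `f` meets it at least twice. -/
def LinesMeetTwice (l : Fin (n + 1) → ℤ) (f : MvPolynomial (Fin (n + 1)) A) : Prop :=
  ∀ v ∈ f.support, ∃ w ∈ f.support, w ≠ v ∧ sideHom l (intVec w) = sideHom l (intVec v)

/-- This is why the point `v` in step 7 may be arbitrary: its own line contains another support
point. -/
lemma LinesMeetTwice.mem_supportDirections {l : Fin (n + 1) → ℤ}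
    {f : MvPolynomial (Fin (n + 1)) A} (h : LinesMeetTwice l f) (hl : IsNormalizedVec l)
    (h0 : ∀ i, l i ≠ 0) {v : Fin (n + 1) →₀ ℕ} (hv : v ∈ f.support) :
    l ∈ supportDirections f v := by
  obtain ⟨w, hw, hne, e⟩ := h v hv
  exact ⟨h0, w, hw, hne, fun h => hne (expPoint_injective h).symm, hl, _,
    sub_eq_of_sideLin_eq (h0 _) ((sideLin_expPoint_eq_iff _ _ _).2 e.symm)⟩

/-- The maximum of `g` is attained at exactly the support points of one line. That line carries at
least two of them, so the exposed face is a nondegenerate segment. -/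
lemma LinesMeetTwice.mem_edges {l : Fin (n + 1) → ℤ}
    {f : MvPolynomial (Fin (n + 1)) A} (h : LinesMeetTwice l f) (hl : IsNormalizedVec l)
    (h0 : l (Fin.last n) ≠ 0) (hf : f ≠ 0) {g : (Fin (n + 1) → ℝ) →L[ℝ] ℝ}
    (hg : ∀ v ∈ f.support, ∀ w ∈ f.support,
      g (expPoint v) = g (expPoint w) ↔ sideHom l (intVec v) = sideHom l (intVec w)) :
    {x ∈ newt f | ∀ y ∈ newt f, g y ≤ g x} ∈ edgesOfDirection f l := by
  refine ⟨fun _ => ⟨g, rfl⟩, ?_⟩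
  have hpos : (0 : ℝ) < l (Fin.last n) := by exact_mod_cast hl.last_pos h0
  obtain ⟨p, hp, hmax⟩ := Finset.exists_max_image f.support (fun m => g (expPoint m))
    (MvPolynomial.support_nonempty.2 hf)
  set T := f.support.filter fun m => sideHom l (intVec m) = sideHom l (intVec p) with hT
  have hpT : p ∈ T := Finset.mem_filter.2 ⟨hp, rfl⟩
  have hset : {x ∈ expPoint '' (f.support : Set (Fin (n + 1) →₀ ℕ)) |
      ∀ y ∈ expPoint '' (f.support : Set (Fin (n + 1) →₀ ℕ)), g y ≤ g x} =
        expPoint '' (T : Set _) := by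
    ext x
    constructor
    · rintro ⟨⟨m, hm, rfl⟩, hx⟩
      refine ⟨m, Finset.mem_filter.2 ⟨hm, (hg m hm p hp).1 (le_antisymm (hmax m hm) ?_)⟩, rfl⟩
      exact hx _ ⟨p, hp, rfl⟩
    · rintro ⟨m, hm, rfl⟩
      obtain ⟨hm, e⟩ := Finset.mem_filter.1 hm
      refine ⟨⟨m, hm, rfl⟩, ?_⟩
      rintro _ ⟨w, hw, rfl⟩
      rw [(hg m hm p hp).2 e]
      exact hmax w hw
  -- Since `l_n ≠ 0`, the last coordinate parametrizes the line; its extremes give the ends of the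
  -- edge.
  obtain ⟨u, hu, humin⟩ := Finset.exists_min_image T (fun m => m (Fin.last n)) ⟨p, hpT⟩
  obtain ⟨v, hv, hvmax⟩ := Finset.exists_max_image T (fun m => m (Fin.last n)) ⟨p, hpT⟩
  have hline : ∀ a ∈ T, ∀ b ∈ T, expPoint a - expPoint b =
      (((a (Fin.last n) : ℝ) - b (Fin.last n)) / l (Fin.last n)) • (fun i => (l i : ℝ)) := by
    intro a ha b hb
    exact sub_eq_of_sideLin_eq h0 ((sideLin_expPoint_eq_iff _ _ _).2
      ((Finset.mem_filter.1 ha).2.trans (Finset.mem_filter.1 hb).2.symm))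
  have hlast : ∀ a ∈ T, ∀ b ∈ T, a (Fin.last n) = b (Fin.last n) → a = b := by
    intro a ha b hb e
    have := hline a ha b hb
    rw [e, sub_self, zero_div, zero_smul, sub_eq_zero] at this
    exact expPoint_injective this
  have huv : u (Fin.last n) < v (Fin.last n) := by
    refine lt_of_le_of_ne (humin v hv) fun e => ?_
    obtain ⟨w, hw, hne, ew⟩ := h p hp
    have hwT : w ∈ T := Finset.mem_filter.2 ⟨hw, ew⟩
    have h1 := humin w hwT
    have h2 := hvmax w hwT
    have h3 := humin p hpT
    have h4 := hvmax p hpT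
    exact hne (hlast w hwT p hpT (by omega))
  have huvR : (u (Fin.last n) : ℝ) < v (Fin.last n) := by exact_mod_cast huv
  refine ⟨expPoint v, expPoint u, ?_, fun e => huv.ne (by rw [expPoint_injective e]), hl, _,
    hline v hv u hu⟩
  rw [newt, toExposed_convexHull (finite_expPoint f), hset]
  apply Set.Subset.antisymm
  · refine convexHull_min ?_ (convex_segment _ _)
    rintro _ ⟨m, hm, rfl⟩
    have h1 : (u (Fin.last n) : ℝ) ≤ m (Fin.last n) := by exact_mod_cast humin m hm
    have h2 : (m (Fin.last n) : ℝ) ≤ v (Fin.last n) := by exact_mod_cast hvmax m hm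
    rw [segment_symm, segment_eq_image']
    have h3 : (v (Fin.last n) : ℝ) - u (Fin.last n) ≠ 0 := by linarith
    refine ⟨((m (Fin.last n) : ℝ) - u (Fin.last n)) / (v (Fin.last n) - u (Fin.last n)),
      ⟨div_nonneg (by linarith) (by linarith), (div_le_one (by linarith)).2 (by linarith)⟩, ?_⟩
    simp only
    rw [hline v hv u hu, smul_smul, ← eq_sub_iff_add_eq', hline m hm u hu]
    congr 1
    field_simp
  · exact segment_subset_convexHull ⟨v, hv, rfl⟩ ⟨u, hu, rfl⟩

lemma IsEdgeDirections.mem_of_linesMeetTwice {l : Fin (n + 1) → ℤ}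
    {f : MvPolynomial (Fin (n + 1)) A} {Λ : Multiset (Fin (n + 1) → ℤ)}
    (hΛ : IsEdgeDirections f Λ) (h : LinesMeetTwice l f) (hl : IsNormalizedVec l)
    (h0 : ∀ i, l i ≠ 0) (hf : f ≠ 0) : l ∈ Λ := by
  obtain ⟨g, hg⟩ := exists_separating_functional l f
  have h1 := h.mem_edges hl (h0 _) hf hg
  rw [← Multiset.count_ne_zero]
  intro hc
  have := (hΛ l).1 h0
  rw [hc, Nat.cast_zero, eq_comm, Set.encard_eq_zero] at this
  rw [this] at h1
  exact h1

lemma newt_subset_of_one_line {l : Fin (n + 1) → ℤ} {f : MvPolynomial (Fin (n + 1)) A}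
    {p : Fin (n + 1) →₀ ℕ}
    (h1 : ∀ v ∈ f.support, sideHom l (intVec v) = sideHom l (intVec p)) :
    ∀ x ∈ newt f, sideLin l x = sideLin l (expPoint p) := by
  intro x hx
  refine convexHull_min (t := {x | sideLin l x = sideLin l (expPoint p)}) ?_ ?_ hx
  · rintro _ ⟨v, hv, rfl⟩
    exact (sideLin_expPoint_eq_iff _ _ _).2 (h1 v hv)
  · exact (convex_singleton (sideLin l (expPoint p))).linear_preimage (sideLin l)

/-- A functional exposing an edge agrees at its two ends, hence kills `l` and is constant on the
polytope, so the only edge is the polytope itself. This excludes the collinear case from the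
multiplicity test. -/
lemma IsEdgeDirections.card_le_one {l : Fin (n + 1) → ℤ} {f : MvPolynomial (Fin (n + 1)) A}
    {Λ : Multiset (Fin (n + 1) → ℤ)} (hΛ : IsEdgeDirections f Λ) (hl : IsNormalizedVec l)
    (h0 : ∀ i, l i ≠ 0) {p : Fin (n + 1) →₀ ℕ}
    (h1 : ∀ v ∈ f.support, sideHom l (intVec v) = sideHom l (intVec p)) :
    Multiset.card Λ ≤ 1 := by
  have hline := newt_subset_of_one_line h1
  have key : ∀ l' F, F ∈ edgesOfDirection f l' → l' = l ∧ F = newt f := by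
    rintro l' F ⟨hF, u, v, rfl, hne, hl', t, ht⟩
    have hu := hF.subset (left_mem_segment ℝ u v)
    have hv := hF.subset (right_mem_segment ℝ u v)
    have huv := sub_eq_of_sideLin_eq (h0 _) ((hline u hu).trans (hline v hv).symm)
    set τ := (u (Fin.last n) - v (Fin.last n)) / (l (Fin.last n) : ℝ)
    have hτ : τ ≠ 0 := by
      intro h
      rw [h, zero_smul, sub_eq_zero] at huv
      exact hne huv
    refine ⟨(hl.eq_of_real_parallel hl' hτ (huv.symm.trans ht)).symm, ?_⟩
    obtain ⟨g, hg⟩ := hF ⟨u, left_mem_segment ℝ u v⟩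
    have hgu : u ∈ {x ∈ newt f | ∀ y ∈ newt f, g y ≤ g x} := hg ▸ left_mem_segment ℝ u v
    have hgv : v ∈ {x ∈ newt f | ∀ y ∈ newt f, g y ≤ g x} := hg ▸ right_mem_segment ℝ u v
    have hgl : g (fun i => (l i : ℝ)) = 0 := by
      have h2 : g u = g v := le_antisymm (hgv.2 u hu) (hgu.2 v hv)
      have h3 := congrArg g huv
      rw [map_sub, h2, sub_self, map_smul, smul_eq_mul, eq_comm, mul_eq_zero] at h3
      exact h3.resolve_left hτ
    have hconst : ∀ x ∈ newt f, g x = g u := fun x hx => by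
      have h3 := congrArg g (sub_eq_of_sideLin_eq (h0 _) ((hline x hx).trans (hline u hu).symm))
      rw [map_smul, hgl, smul_zero, map_sub] at h3
      linarith
    rw [hg]
    exact Set.Subset.antisymm (Set.sep_subset _ _) fun x hx =>
      ⟨hx, fun y hy => by rw [hconst x hx, hconst y hy]⟩
  have hall : ∀ l' ∈ Λ, l' = l := by
    intro l' hl'
    by_cases h0' : ∀ i, l' i ≠ 0
    · have hc := (hΛ l').1 h0'
      have : (edgesOfDirection f l').Nonempty := by
        rw [← Set.encard_ne_zero, ← hc, Nat.cast_ne_zero,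
          Multiset.count_ne_zero]
        exact hl'
      obtain ⟨F, hF⟩ := this
      exact (key l' F hF).1
    · push Not at h0'
      exact absurd ((hΛ l').2 h0') (Multiset.count_ne_zero.2 hl')
  rw [← Multiset.count_eq_card.2 fun l' h => (hall l' h).symm]
  have hc := (hΛ l).1 h0
  have : (edgesOfDirection f l).encard ≤ 1 :=
    Set.encard_le_one_iff.2 fun F F' hF hF' => (key l F hF).2.trans (key l F' hF').2.symm
  rw [← hc] at this
  exact_mod_cast this

/-- A separating functional `g` and its negative expose edges with direction `l`. If these
coincided, `g` would be constant and the support would lie on one line. -/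
lemma IsEdgeDirections.two_le_count {l : Fin (n + 1) → ℤ}
    {f : MvPolynomial (Fin (n + 1)) A} {Λ : Multiset (Fin (n + 1) → ℤ)}
    (hΛ : IsEdgeDirections f Λ) (h : LinesMeetTwice l f) (hl : IsNormalizedVec l)
    (h0 : ∀ i, l i ≠ 0) (hf : f ≠ 0) (hcard : 1 < Multiset.card Λ) : 2 ≤ Λ.count l := by
  obtain ⟨p, hp⟩ := MvPolynomial.support_nonempty.2 hf
  obtain ⟨w, hw, hne⟩ : ∃ w ∈ f.support, sideHom l (intVec w) ≠ sideHom l (intVec p) := by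
    by_contra hcon
    push Not at hcon
    exact absurd (hΛ.card_le_one hl h0 hcon) (by omega)
  obtain ⟨g, hg⟩ := exists_separating_functional l f
  have h1 := h.mem_edges hl (h0 _) hf hg
  have h2 := h.mem_edges hl (h0 _) hf (g := -g) (by simpa using hg)
  have hc := (hΛ l).1 h0
  have : 1 < (edgesOfDirection f l).encard := by
    refine Set.one_lt_encard_iff.2 ⟨_, _, h1, h2, fun e => ?_⟩
    obtain ⟨-, u, v, e', -⟩ := h1
    have hu : u ∈ {x ∈ newt f | ∀ y ∈ newt f, g y ≤ g x} := e' ▸ left_mem_segment ℝ u v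
    have hu' : u ∈ {x ∈ newt f | ∀ y ∈ newt f, (-g) y ≤ (-g) x} := e ▸ hu
    have hconst : ∀ y ∈ newt f, g y = g u := fun y hy =>
      le_antisymm (hu.2 y hy) (by simpa using hu'.2 y hy)
    have hmem : ∀ m ∈ f.support, expPoint m ∈ newt f := fun m hm =>
      subset_convexHull ℝ _ ⟨m, hm, rfl⟩
    exact hne ((hg w hw p hp).1 ((hconst _ (hmem w hw)).trans (hconst _ (hmem p hp)).symm))
  rw [← hc] at this
  exact_mod_cast this

lemma IsEdgeDirections.of_mem {f : MvPolynomial (Fin n) A} {Λ : Multiset (Fin n → ℤ)}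
    (hΛ : IsEdgeDirections f Λ) {l : Fin n → ℤ} (hl : l ∈ Λ) :
    IsNormalizedVec l ∧ ∀ i, l i ≠ 0 := by
  have h0 : ∀ i, l i ≠ 0 := by
    by_contra h
    push Not at h
    exact absurd ((hΛ l).2 h) (Multiset.count_ne_zero.2 hl)
  have hc := (hΛ l).1 h0
  have : (edgesOfDirection f l).Nonempty := by
    rw [← Set.encard_ne_zero, ← hc, Nat.cast_ne_zero,
      Multiset.count_ne_zero]
    exact hl
  obtain ⟨F, -, u, v, -, -, h, -⟩ := this
  exact ⟨h, h0⟩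

end Edges

/-! ### Normalizing integer vectors -/

section Vectors

variable {n : ℕ}

/-- Divide by the gcd of the coordinates, negated if the rightmost nonzero coordinate is negative.
-/
lemma exists_normalized {l : Fin n → ℤ} (hl : l ≠ 0) :
    ∃ (l' : Fin n → ℤ) (k : ℤ), IsNormalizedVec l' ∧ l = k • l' := by
  classical
  obtain ⟨i₀, hi₀⟩ := Function.ne_iff.1 hl
  obtain ⟨g, hg, hg1⟩ := Finset.extract_gcd l (Finset.univ_nonempty_iff.2 ⟨i₀⟩)
  have hg0 : g i₀ ≠ 0 := fun h => hi₀ (by rw [hg i₀ (Finset.mem_univ _), h, mul_zero]; rfl)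
  obtain ⟨k, hk, hmax⟩ := Finset.exists_max_image (Finset.univ.filter fun i => g i ≠ 0) id
    ⟨i₀, by simpa using hg0⟩
  have hz : ∀ j, k < j → g j = 0 := fun j hj => by
    by_contra h
    exact absurd (hmax j (by simpa using h)) (not_le.2 hj)
  have hk0 : g k ≠ 0 := by simpa using hk
  rcases hk0.lt_or_gt with h | h
  · refine ⟨-g, -Finset.univ.gcd l, ⟨?_, k, by simpa using h, fun j hj => by simp [hz j hj]⟩, ?_⟩
    · have := Finset.gcd_mul_left (s := Finset.univ) (f := g) (a := (-1 : ℤ))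
      rw [hg1, mul_one, normalize_eq_one.2 (by simp)] at this
      simpa [Pi.neg_def] using this
    · ext i; simp [hg i (Finset.mem_univ _)]
  · exact ⟨g, Finset.univ.gcd l, ⟨hg1, k, h, hz⟩, by ext i; simp [hg i (Finset.mem_univ _)]⟩

lemma IsNormalizedVec.insertZero {l : Fin n → ℤ} (h : IsNormalizedVec l) (i : Fin (n + 1)) :
    IsNormalizedVec (insertZero i l) := by
  obtain ⟨h1, k, hk, hk0⟩ := h
  refine ⟨?_, i.succAbove k, by simpa [QILD.insertZero] using hk, fun j => ?_⟩
  · have : Finset.univ.gcd (QILD.insertZero i l) ∣ 1 := by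
      rw [← h1]
      refine Finset.dvd_gcd fun j _ => ?_
      have := Finset.gcd_dvd (f := QILD.insertZero i l) (Finset.mem_univ (i.succAbove j))
      simpa [QILD.insertZero] using this
    rw [← Finset.normalize_gcd]
    exact normalize_eq_one.2 (isUnit_of_dvd_one this)
  · refine Fin.succAboveCases i ?_ (fun j => ?_) j
    · intro _; simp [QILD.insertZero]
    · intro hj
      rw [Fin.succAbove_lt_succAbove_iff] at hj
      simpa [QILD.insertZero] using hk0 j hj

end Vectors

/-! ### Factors of polynomials without factors that miss a variable -/

section Factors

variable {A : Type*} [CommRing A] [IsDomain A] {n : ℕ}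

lemma PrimAt.not_X_dvd {i j : Fin (n + 1)} (hij : i ≠ j) {f : MvPolynomial (Fin (n + 1)) A}
    (h : PrimAt j f) : ¬ MvPolynomial.X i ∣ f := by
  intro hd
  obtain ⟨i, rfl⟩ := Fin.exists_succAbove_eq hij
  refine (MvPolynomial.X_prime (R := A) (i := i)).not_isUnit (h _ ?_)
  simpa [embedAt] using hd

/-- A second variable is essential: `x_i` is a nonunit that misses `x_j`. The univariate case is
therefore treated apart. -/
lemma not_X_dvd_of_forall_primAt {f : MvPolynomial (Fin (n + 2)) A} (h : ∀ j, PrimAt j f)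
    (i : Fin (n + 2)) : ¬ MvPolynomial.X i ∣ f := by
  obtain ⟨j, hj⟩ := exists_ne i
  exact (h j).not_X_dvd hj.symm

/-- A polynomial of positive degree that is not divisible by a variable has two terms. -/
lemma exists_ne_mem_support {m : ℕ} {u : MvPolynomial (Fin m) A} (hu : 0 < u.totalDegree)
    (hX : ∀ i, ¬ MvPolynomial.X i ∣ u) : ∃ a ∈ u.support, ∃ b ∈ u.support, a ≠ b := by
  have hu0 : u ≠ 0 := by rintro rfl; simp at hu
  obtain ⟨a, ha⟩ := MvPolynomial.support_nonempty.2 hu0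
  by_contra h
  push Not at h
  have hall : ∀ b ∈ u.support, b = a := fun b hb => h b hb a ha
  have ha0 : a = 0 := by
    ext i
    by_contra hi
    exact hX i (X_dvd_iff_support.2 fun b hb => by rwa [hall b hb])
  refine hu.ne' (Nat.le_zero.1 (Finset.sup_le fun b hb => ?_))
  rw [hall b hb, ha0]
  simp

/-- An irreducible `q`-integer linear factor of a polynomial without factors that miss a variable
is aligned with a normalized vector without zero coordinates. -/
lemma exists_aligned_of_isQIntegerLinear {f u : MvPolynomial (Fin (n + 2)) A}
    (hf : ∀ j, PrimAt j f) (hd : u ∣ f) (hu : 0 < u.totalDegree) (hq : IsQIntegerLinear u) :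
    ∃ l, IsNormalizedVec l ∧ (∀ i, l i ≠ 0) ∧ Aligned l u := by
  have hX : ∀ i, ¬ MvPolynomial.X i ∣ u := fun i h =>
    not_X_dvd_of_forall_primAt hf i (h.trans hd)
  obtain ⟨m, hm, m', hm', hne⟩ := exists_ne_mem_support hu hX
  obtain ⟨P, a, l₀, e⟩ := hq
  have hsupp : ∀ m ∈ u.support, ∃ k : ℕ, intVec m = a + k • l₀ := fun m hm => by
    have h1 : (toLaurent u).coeff (intVec m) ≠ 0 := by
      rw [coeff_toLaurent]; exact MvPolynomial.mem_support_iff.1 hm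
    rw [e, coeff_mono_mul] at h1
    obtain ⟨k, -, hk⟩ := exists_of_coeff_substMono_ne_zero h1
    exact ⟨k, by rw [hk]; abel⟩
  have hl₀ : l₀ ≠ 0 := by
    rintro rfl
    obtain ⟨k, hk⟩ := hsupp m hm
    obtain ⟨k', hk'⟩ := hsupp m' hm'
    exact hne (intVec_injective (by rw [hk, hk', smul_zero, smul_zero]))
  obtain ⟨l, c, hl, rfl⟩ := exists_normalized hl₀
  refine ⟨l, hl, fun i hi => ?_, a, fun m hm => ?_⟩
  -- If `l i = 0`, the exponent of `x_i` is constant on the support, hence `0` as `x_i` does not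
  -- divide `u`; then `u` misses `x_i` and must be a unit.
  · have hconst : ∀ m ∈ u.support, (m i : ℤ) = a i := fun m hm => by
      obtain ⟨k, hk⟩ := hsupp m hm
      have := congrFun hk i
      simpa [intVec, hi] using this
    have h0 : ∀ m ∈ u.support, m i = 0 := by
      obtain ⟨w, hw, hw0⟩ : ∃ w ∈ u.support, w i = 0 := by
        have := hX i
        rw [X_dvd_iff_support] at this
        push Not at this
        exact this
      intro m hm
      have h1 := hconst m hm
      have h2 := hconst w hw
      omega
    obtain ⟨u', rfl⟩ := exists_embedAt_eq_of_support h0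
    have hunit := (hf i u' hd).map (embedAt (A := A) i)
    rw [MvPolynomial.isUnit_iff_totalDegree_of_isReduced] at hunit
    exact hu.ne' hunit.2
  · obtain ⟨k, hk⟩ := hsupp m hm
    exact ⟨k * c, by rw [hk, mul_smul, natCast_zsmul]⟩

end Factors

/-! ### Validity of the data and distinctness of types -/

section Valid

variable {A : Type*} [CommRing A] {n : ℕ}

/-- The conditions on the data of a `q`-integer linear decomposition. -/
structure Decomp.Valid (d : Decomp A n) : Prop where
  primitive_P₀ : IsPrimitive d.P₀
  not_qil_P₀ : ∀ h : MvPolynomial (Fin n) A,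
    Irreducible h → h ∣ d.P₀ → 0 < h.totalDegree → ¬ IsQIntegerLinear h
  qprimitive : ∀ t ∈ d.factors, IsQPrimitive t.2 ∧ 0 < t.2.natDegree
  normalized : ∀ t ∈ d.factors, IsNormalizedVec t.1
  distinct : (d.factors.map Prod.fst).Nodup

lemma isQILD_iff {p : MvPolynomial (Fin n) A} {d : Decomp A n} :
    IsQILD p d ↔ toLaurent p = d.value ∧ d.Valid :=
  ⟨fun h => ⟨h.1, h.2, h.3, h.4, h.5, h.6⟩, fun h => ⟨h.1, h.2.1, h.2.2, h.2.3, h.2.4, h.2.5⟩⟩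

variable [IsDomain A] [UniqueFactorizationMonoid A]

lemma Decomp.valid_of_one (c : A) (α : Fin n → ℕ) : (⟨c, α, 1, []⟩ : Decomp A n).Valid where
  primitive_P₀ := isPrimitive_iff_primC.2 PrimC.one
  not_qil_P₀ h hi hd := absurd (isUnit_of_dvd_one hd) hi.not_isUnit
  qprimitive := by simp
  normalized := by simp
  distinct := by simp

lemma Decomp.Valid.setC {d : Decomp A n} (h : d.Valid) (c : A) : ({d with c := c}).Valid :=
  ⟨h.1, h.2, h.3, h.4, h.5⟩

lemma Decomp.value_setC (d : Decomp A n) (c : A) :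
    ({d with c := d.c * c} : Decomp A n).value = d.value * c • 1 := by
  simp only [Decomp.value, Algebra.smul_def, map_mul]
  ring

lemma Decomp.Valid.mul_P₀ {d : Decomp A n} (h : d.Valid) {f : MvPolynomial (Fin n) A}
    (hf : PrimC f) (hq : ∀ u : MvPolynomial (Fin n) A, Irreducible u → u ∣ f →
      0 < u.totalDegree → ¬ IsQIntegerLinear u) : ({d with P₀ := d.P₀ * f}).Valid where
  primitive_P₀ := isPrimitive_iff_primC.2 ((isPrimitive_iff_primC.1 h.1).mul hf)
  not_qil_P₀ u hu hd hdeg := by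
    rcases hu.prime.dvd_or_dvd hd with h' | h'
    · exact h.not_qil_P₀ u hu h' hdeg
    · exact hq u hu h' hdeg
  qprimitive := h.3
  normalized := h.4
  distinct := h.5

lemma Decomp.value_mul_P₀ (d : Decomp A n) (f : MvPolynomial (Fin n) A) :
    ({d with P₀ := d.P₀ * f} : Decomp A n).value = d.value * toLaurent f := by
  simp only [Decomp.value, Algebra.smul_def, map_mul]
  ring

lemma Decomp.value_append (d : Decomp A n) (l : Fin n → ℤ) (Q : Polynomial A)
    (b : Fin n → ℕ) :
    (⟨d.c, d.α + b, d.P₀, d.factors ++ [(l, Q)]⟩ : Decomp A n).value =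
      d.value * (mono A (fun i => (b i : ℤ)) * substMono Q l) := by
  have : (fun i => (((d.α + b) i : ℕ) : ℤ)) = (fun i => (d.α i : ℤ)) + fun i => (b i : ℤ) := by
    ext i; simp
  simp only [Decomp.value, this, mono_add, List.map_append, List.map_cons, List.map_nil,
    List.prod_append, List.prod_singleton, Algebra.smul_def]
  ring

lemma Decomp.Valid.append {d : Decomp A n} (h : d.Valid) {l : Fin n → ℤ} {Q : Polynomial A}
    (b : Fin n → ℕ) (hl : IsNormalizedVec l) (hQ : IsQPrimitive Q) (hdeg : 0 < Q.natDegree)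
    (hnew : ∀ t ∈ d.factors, t.1 ≠ l) :
    (⟨d.c, d.α + b, d.P₀, d.factors ++ [(l, Q)]⟩ : Decomp A n).Valid where
  primitive_P₀ := h.1
  not_qil_P₀ := h.2
  qprimitive t ht := by
    rcases List.mem_append.1 ht with ht | ht
    · exact h.3 t ht
    · rw [List.mem_singleton.1 ht]; exact ⟨hQ, hdeg⟩
  normalized t ht := by
    rcases List.mem_append.1 ht with ht | ht
    · exact h.4 t ht
    · rw [List.mem_singleton.1 ht]; exact hl
  distinct := by
    rw [List.map_append, List.nodup_append]
    refine ⟨h.5, by simp, ?_⟩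
    rintro _ ha _ hb
    obtain ⟨t, ht, rfl⟩ := List.mem_map.1 ha
    simp only [List.map_cons, List.map_nil, List.mem_singleton] at hb
    rw [hb]
    exact hnew t ht

/-- Irreducible divisors of the embedded `P₀` miss `x_i` and come from irreducible divisors of
`e.P₀`, where `q`-integer linear ones are excluded. -/
lemma Decomp.Valid.merge {d : Decomp A (n + 1)} (h : d.Valid) {e : Decomp A n} (he : e.Valid)
    (i : Fin (n + 1))
    (hnew : ∀ t ∈ d.factors, ∀ t' ∈ e.factors, t.1 ≠ insertZero i t'.1) :
    (d.merge i e).Valid := by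
  have hP₀ : PrimC e.P₀ := isPrimitive_iff_primC.1 he.1
  have hemb : PrimC (embedAt i e.P₀) := fun r hr => hP₀ r (by
    rw [MvPolynomial.C_dvd_iff_dvd_coeff]
    have h1 : embedAt i (MvPolynomial.C r) ∣ embedAt i e.P₀ := by
      simpa [embedAt] using hr
    rw [embedAt_dvd_iff, asPolyIn_embedAt] at h1
    have h2 := h1 0
    rw [Polynomial.coeff_C_zero] at h2
    exact (MvPolynomial.C_dvd_iff_dvd_coeff _ _).1 h2)
  obtain ⟨h1, h2, -, -, -⟩ := h.mul_P₀ hemb (fun u hu hd hdeg hq => by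
    obtain ⟨u', rfl⟩ := exists_embedAt_eq_of_dvd hP₀.ne_zero hd
    refine he.not_qil_P₀ u' (irreducible_of_irreducible_embedAt hu) ?_ ?_ hq.of_embedAt
    · rw [embedAt_dvd_iff, asPolyIn_embedAt] at hd
      simpa using hd 0
    · exact lt_of_lt_of_le hdeg (MvPolynomial.totalDegree_rename_le _ _))
  refine ⟨h1, h2, fun t ht => ?_, fun t ht => ?_, ?_⟩
  · rcases List.mem_append.1 ht with ht | ht
    · exact h.3 t ht
    · obtain ⟨t', ht', rfl⟩ := List.mem_map.1 ht
      exact he.3 t' ht'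
  · rcases List.mem_append.1 ht with ht | ht
    · exact h.4 t ht
    · obtain ⟨t', ht', rfl⟩ := List.mem_map.1 ht
      exact (he.4 t' ht').insertZero i
  · have e1 : ((e.factors.map fun t => (i.insertNth (α := fun _ => ℤ) 0 t.1, t.2)).map Prod.fst) =
        (e.factors.map Prod.fst).map (insertZero i) := by
      simp [List.map_map, Function.comp_def, insertZero_apply]
    rw [Decomp.merge, List.map_append, e1, List.nodup_append]
    refine ⟨h.5, he.5.map (insertZero_injective i), ?_⟩
    rintro _ ha _ hb
    obtain ⟨t, ht, rfl⟩ := List.mem_map.1 ha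
    obtain ⟨_, hc, rfl⟩ := List.mem_map.1 hb
    obtain ⟨t', ht', rfl⟩ := List.mem_map.1 hc
    exact hnew t ht t' ht'

/-- The types of the decomposition of a polynomial without factors that miss `x_j` do not
vanish at `j`. -/
lemma IsQILD.type_ne_zero {g : MvPolynomial (Fin (n + 1)) A} {e : Decomp A (n + 1)}
    (he : IsQILD g e) {f : MvPolynomial (Fin (n + 2)) A} {k j : Fin (n + 2)} (hjk : j ≠ k)
    (hd : embedAt k g ∣ f) (hf : PrimAt j f) {t : (Fin (n + 1) → ℤ) × Polynomial A}
    (ht : t ∈ e.factors) : insertZero k t.1 j ≠ 0 := by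
  obtain ⟨j, rfl⟩ := Fin.exists_succAbove_eq hjk
  intro h0
  replace h0 : t.1 j = 0 := by simpa [insertZero] using h0
  obtain ⟨h, b, hh⟩ := exists_isNumDen (substMono t.2 t.1)
  have hl0 := (he.normalized t ht).ne_zero
  obtain ⟨⟨-, hQ0⟩, hdeg⟩ := he.qprimitive t ht
  have hX := hh.not_X_dvd hl0 hQ0
  have hg : h ∣ g := by
    refine dvd_of_toLaurent_dvd hX ?_
    rw [hh.1]
    refine ((isUnit_mono _).mul_left_dvd).2 ?_
    rw [he.eq_value, Decomp.value, Algebra.smul_def]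
    refine Dvd.dvd.mul_left ?_ _
    exact Dvd.dvd.mul_left (List.dvd_prod (List.mem_map.2 ⟨t, ht, rfl⟩)) _
  have hsupp : ∀ m ∈ h.support, m j = 0 := by
    have hconst : ∀ m ∈ h.support, m j = b j := fun m hm => by
      obtain ⟨r, -, hr⟩ := hh.exists_of_mem_support hm
      have := congrFun hr j
      simpa [intVec, h0] using this
    have := hX j
    rw [X_dvd_iff_support] at this
    push Not at this
    obtain ⟨w, hw, hw0⟩ := this
    intro m hm
    rw [hconst m hm, ← hconst w hw, hw0]
  obtain ⟨h', hh'⟩ : ∃ h', embedAt k h = embedAt (k.succAbove j) h' := by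
    refine exists_embedAt_eq_of_support fun m hm => ?_
    classical
    rw [embedAt, MvPolynomial.support_rename_of_injective Fin.succAbove_right_injective,
      Finset.mem_image] at hm
    obtain ⟨m, hm, rfl⟩ := hm
    rw [Finsupp.mapDomain_apply Fin.succAbove_right_injective]
    exact hsupp m hm
  -- With `t.1 j = 0` the numerator `h` also misses the variable `k.succAbove j`, so it is a unit.
  have hunit : IsUnit h := by
    apply isUnit_of_isUnit_embedAt (i := k)
    rw [hh']
    refine (hf h' ?_).map _
    rw [← hh']
    exact (map_dvd _ hg).trans hd
  rw [MvPolynomial.isUnit_iff_totalDegree_of_isReduced] at hunit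
  -- The constant and leading terms of `t.2` yield two different terms of `h`, which a unit cannot
  -- have.
  obtain ⟨m, hm, em⟩ := hh.exists_mem_support hl0 hQ0
  obtain ⟨m', hm', em'⟩ := hh.exists_mem_support hl0 (k := t.2.natDegree)
    (by rw [← Polynomial.leadingCoeff, Polynomial.leadingCoeff_ne_zero]; rintro h; simp [h] at hdeg)
  have hz : ∀ w ∈ h.support, w = 0 := fun w hw => by
    classical
    rw [MvPolynomial.totalDegree_eq_zero_iff_eq_C.1 hunit.2, MvPolynomial.mem_support_iff,
      MvPolynomial.coeff_C] at hw
    exact by_contra fun h => hw (if_neg fun h' => h h'.symm)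
  rw [hz m hm, zero_smul, add_zero] at em
  rw [hz m' hm', em, left_eq_add, ← natCast_zsmul, smul_eq_zero] at em'
  rcases em' with h | h
  · simp at h; omega
  · exact hl0 h

end Valid

/-! ### Runs of the algorithm -/

section Runs

variable {A : Type*} [CommRing A] {N : ℕ}

/-- All runs from the configuration are finite and end in a final configuration whose output is
the `q`-integer linear decomposition of `p`. -/
inductive Good (p : MvPolynomial (Fin N) A) : Config A N → Prop
  | intro (cfg : Config A N) (hstep : ∀ cfg', Step cfg cfg' → Good p cfg')
      (hstuck : (∀ cfg', ¬ Step cfg cfg') → ∃ d, cfg = final d ∧ IsQILD p d) : Good p cfg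

/-- `Good` is an inductive predicate, so the tree of runs below a good configuration is
well-founded. -/
lemma Good.no_infinite_run {p : MvPolynomial (Fin N) A} {cfg : Config A N} (h : Good p cfg) :
    ¬ ∃ run : ℕ → Config A N, run 0 = cfg ∧ ∀ k, Step (run k) (run (k + 1)) := by
  induction h with
  | intro cfg _ _ ih =>
    rintro ⟨run, rfl, hrun⟩
    exact ih _ (hrun 0) ⟨fun k => run (k + 1), rfl, fun k => hrun (k + 1)⟩

lemma Good.of_reachable {p : MvPolynomial (Fin N) A} {cfg cfg' : Config A N} (h : Good p cfg)
    (hr : Relation.ReflTransGen Step cfg cfg') : Good p cfg' := by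
  induction hr with
  | refl => exact h
  | tail _ hs ih => cases ih with | intro _ hstep _ => exact hstep _ hs

lemma Good.of_local {p : MvPolynomial (Fin N) A} {n : ℕ} {s : State A n} {st : Stack A N n}
    (honly : ∀ cfg, Step ⟨s, st⟩ cfg → ∃ s', LocalStep s s' ∧ cfg = ⟨s', st⟩)
    (hex : ∃ s', LocalStep s s') (h : ∀ s', LocalStep s s' → Good p ⟨s', st⟩) :
    Good p ⟨s, st⟩ := by
  refine ⟨_, fun cfg hs => ?_, fun hstuck => ?_⟩
  · obtain ⟨s', hs', rfl⟩ := honly _ hs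
    exact h s' hs'
  · obtain ⟨s', hs'⟩ := hex
    exact absurd (Step.inside hs') (hstuck _)

/-- The configuration to which an invocation on input `q` returns is good. -/
def GoodReturn (p : MvPolynomial (Fin N) A) {n : ℕ} (q : MvPolynomial (Fin n) A)
    (st : Stack A N n) : Prop :=
  ∀ e, IsQILD q e → Good p ⟨.done e, st⟩

lemma goodReturn_nil (p : MvPolynomial (Fin N) A) : GoodReturn p p .nil := fun e he =>
  ⟨_, fun _ hs => (by cases hs with | inside h => cases h), fun _ => ⟨e, rfl, he⟩⟩

end Runs

/-! ### Loop invariants and correctness of an invocation -/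

section Invocation

variable {A : Type*} [CommRing A] [IsDomain A] [UniqueFactorizationMonoid A] {N n : ℕ}

/-- The invariant of the loops: the input is the value of the data times `f`. -/
structure Inv (q : MvPolynomial (Fin n) A) (d : Decomp A n) (f : MvPolynomial (Fin n) A) :
    Prop where
  value : toLaurent q = d.value * toLaurent f
  valid : d.Valid
  prim : PrimC f

lemma Inv.isQILD_of_constant {q : MvPolynomial (Fin n) A} {d : Decomp A n}
    {f : MvPolynomial (Fin n) A} (h : Inv q d f) (hf : f.totalDegree = 0) :
    IsQILD q { d with c := d.c * f.coeff 0 } := by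
  rw [isQILD_iff]
  refine ⟨?_, h.valid.setC _⟩
  rw [Decomp.value_setC, ← toLaurent_C, ← MvPolynomial.totalDegree_eq_zero_iff_eq_C.1 hf, h.value]

/-- The invariant of the loop over the candidates. -/
structure TypeInv (q : MvPolynomial (Fin (n + 2)) A) (L : Finset (Fin (n + 2) → ℤ))
    (d : Decomp A (n + 2)) (f : MvPolynomial (Fin (n + 2)) A) : Prop extends Inv q d f where
  primAt : ∀ i, PrimAt i f
  fresh : ∀ t ∈ d.factors, t.1 ∉ L
  candidates : ∀ l ∈ L, IsNormalizedVec l ∧ ∀ i, l i ≠ 0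
  complete : ∀ u : MvPolynomial (Fin (n + 2)) A, u ∣ f → 0 < u.totalDegree →
    IsQIntegerLinear u → ∃ l ∈ L, Aligned l u

lemma TypeInv.not_X_dvd {q : MvPolynomial (Fin (n + 2)) A} {L : Finset (Fin (n + 2) → ℤ)}
    {d : Decomp A (n + 2)} {f : MvPolynomial (Fin (n + 2)) A} (h : TypeInv q L d f)
    (i : Fin (n + 2)) : ¬ MvPolynomial.X i ∣ f :=
  not_X_dvd_of_forall_primAt h.primAt i

/-- An aligned factor has two terms and would give the content positive degree, so `l` is not needed
for completeness. -/
lemma TypeInv.reject {q : MvPolynomial (Fin (n + 2)) A} {L : Finset (Fin (n + 2) → ℤ)}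
    {d : Decomp A (n + 2)} {f : MvPolynomial (Fin (n + 2)) A} (h : TypeInv q L d f)
    {l : Fin (n + 2) → ℤ} {P : Polynomial A} (hl : l ∈ L) (hP : IsTypeContent l f P)
    (hdeg : P.natDegree = 0) : TypeInv q (L.erase l) d f where
  toInv := h.toInv
  primAt := h.primAt
  fresh t ht hmem := h.fresh t ht (Finset.mem_of_mem_erase hmem)
  candidates l' hl' := h.candidates l' (Finset.mem_of_mem_erase hl')
  complete u hd hu hq := by
    obtain ⟨l', hl', ha⟩ := h.complete u hd hu hq
    refine ⟨l', Finset.mem_erase.2 ⟨?_, hl'⟩, ha⟩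
    rintro rfl
    obtain ⟨m, hm, m', hm', hne⟩ :=
      exists_ne_mem_support hu fun i hi => h.not_X_dvd i (hi.trans hd)
    have h0 := (h.candidates l' hl).2 (Fin.last _)
    have hP0 : P ≠ 0 := by
      rintro rfl; exact hP.coeff_zero_ne_zero h0 (h.not_X_dvd _) (Polynomial.coeff_zero 0)
    exact (hP.natDegree_pos h0 hP0 hd ha hm hm' hne).ne' hdeg

/-- No factor aligned with `l` survives the division, so `l` may be discarded; this in turn keeps
the recorded types distinct. -/
lemma TypeInv.accept {q : MvPolynomial (Fin (n + 2)) A} {L : Finset (Fin (n + 2) → ℤ)}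
    {d : Decomp A (n + 2)} {f f' g : MvPolynomial (Fin (n + 2)) A} (h : TypeInv q L d f)
    {l : Fin (n + 2) → ℤ} {Q : Polynomial A} {b : Fin (n + 2) → ℕ} (hl : l ∈ L)
    (hP : IsTypeContent l f (Polynomial.expand A (l (Fin.last (n + 1))).toNat Q))
    (hdeg : 0 < (Polynomial.expand A (l (Fin.last (n + 1))).toNat Q).natDegree)
    (hg : IsNumDen (substMono Q l) g b) (hf : f = f' * g) :
    TypeInv q (L.erase l) ⟨d.c, d.α + b, d.P₀, d.factors ++ [(l, Q)]⟩ f' := by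
  have hnorm := (h.candidates l hl).1
  have hpos := hnorm.last_pos ((h.candidates l hl).2 _)
  have hd' : f' ∣ f := ⟨g, hf⟩
  have hQdeg : 0 < Q.natDegree := by
    rw [Polynomial.natDegree_expand] at hdeg
    exact Nat.pos_of_mul_pos_right hdeg
  have hQ0 : Q ≠ 0 := by rintro rfl; simp at hQdeg
  refine ⟨⟨?_, ?_, h.prim.of_dvd hd'⟩, fun i => (h.primAt i).of_dvd hd', ?_, ?_, ?_⟩
  · rw [Decomp.value_append, h.value, hf, map_mul, hg.1]
    ring
  · exact h.valid.append b hnorm (hP.isQPrimitive hpos (h.not_X_dvd _) h.prim) hQdeg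
      fun t ht e => h.fresh t ht (e ▸ hl)
  · intro t ht hmem
    rcases List.mem_append.1 ht with ht | ht
    · exact h.fresh t ht (Finset.mem_of_mem_erase hmem)
    · rw [List.mem_singleton.1 ht] at hmem
      exact Finset.notMem_erase _ _ hmem
  · exact fun l' hl' => h.candidates l' (Finset.mem_of_mem_erase hl')
  · intro u hd hu hq
    obtain ⟨l', hl', ha⟩ := h.complete u (hd.trans hd') hu hq
    refine ⟨l', Finset.mem_erase.2 ⟨?_, hl'⟩, ha⟩
    rintro rfl
    obtain ⟨m, hm, m', hm', hne⟩ :=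
      exists_ne_mem_support hu fun i hi => h.not_X_dvd i (hi.trans (hd.trans hd'))
    exact hP.not_aligned_of_eq_mul hpos hQ0 hg hf hd hm hm' hne ha

lemma TypeInv.good {p : MvPolynomial (Fin N) A} {q : MvPolynomial (Fin (n + 2)) A}
    {st : Stack A N (n + 2)} (hr : GoodReturn p q st) {L : Finset (Fin (n + 2) → ℤ)}
    {d : Decomp A (n + 2)} {f : MvPolynomial (Fin (n + 2)) A} (h : TypeInv q L d f) :
    Good p ⟨.typeLoop L d f, st⟩ := by
  induction hL : L.card generalizing L d f with
  | zero =>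
    obtain rfl := Finset.card_eq_zero.1 hL
    refine Good.of_local (fun cfg hs => ?_) ?_ fun s' hs => ?_
    · cases hs with | inside h => exact ⟨_, h, rfl⟩
    · rcases Nat.eq_zero_or_pos f.totalDegree with h0 | h0
      · exact ⟨_, .returnConstant h0⟩
      · exact ⟨_, .returnRest h0⟩
    · cases hs with
      | rejectType hl => simp at hl
      | acceptType hl => simp at hl
      | returnRest hf =>
        refine hr _ (isQILD_iff.2 ⟨?_, h.valid.mul_P₀ h.prim fun u _ hd hu hq => ?_⟩)
        · rw [Decomp.value_mul_P₀, h.value]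
        · obtain ⟨l, hl, -⟩ := h.complete u hd hu hq
          simp at hl
      | returnConstant hf => exact hr _ (h.isQILD_of_constant hf)
  | succ r ih =>
    have hne : L.Nonempty := Finset.card_pos.1 (by omega)
    refine Good.of_local (fun cfg hs => ?_) ?_ fun s' hs => ?_
    · cases hs with | inside h => exact ⟨_, h, rfl⟩
    · obtain ⟨l, hl⟩ := hne
      obtain ⟨P, hP⟩ := exists_isTypeContent l f
      rcases Nat.eq_zero_or_pos P.natDegree with h0 | h0
      · exact ⟨_, .rejectType hl hP h0⟩
      · obtain ⟨hnorm, hz⟩ := h.candidates l hl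
        have hpos := hnorm.last_pos (hz _)
        obtain ⟨Q, rfl⟩ := hP.exists_eq_expand hnorm.1 hpos (h.not_X_dvd _)
        obtain ⟨g, b, hg⟩ := exists_isNumDen (substMono Q l)
        obtain ⟨f', hf'⟩ := hP.numerator_dvd hpos (h.not_X_dvd _) hg
        exact ⟨_, .acceptType hl hP h0 rfl hg (hf'.trans (mul_comm _ _))⟩
    · cases hs with
      | rejectType hl hP hdeg =>
        exact ih (h.reject hl hP hdeg) (by rw [Finset.card_erase_of_mem hl]; omega)
      | acceptType hl hP hdeg hQ hh hf =>
        subst hQ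
        exact ih (h.accept hl hP hdeg hh hf) (by rw [Finset.card_erase_of_mem hl]; omega)
      | returnRest => simp at hL
      | returnConstant => simp at hL

/-- The invariant after the loop over the variables. -/
structure EdgeInv (q : MvPolynomial (Fin (n + 2)) A) (d : Decomp A (n + 2))
    (f : MvPolynomial (Fin (n + 2)) A) : Prop extends Inv q d f where
  primAt : ∀ i, PrimAt i f
  has_zero : ∀ t ∈ d.factors, ∃ i, t.1 i = 0

/-- A candidate set that contains all directions in which every line meets the support twice. -/
lemma EdgeInv.typeInv {q : MvPolynomial (Fin (n + 2)) A} {d : Decomp A (n + 2)}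
    {f : MvPolynomial (Fin (n + 2)) A} (h : EdgeInv q d f) {L : Finset (Fin (n + 2) → ℤ)}
    (hL : ∀ l ∈ L, IsNormalizedVec l ∧ ∀ i, l i ≠ 0)
    (hall : ∀ l, IsNormalizedVec l → (∀ i, l i ≠ 0) → LinesMeetTwice l f → l ∈ L) :
    TypeInv q L d f where
  toInv := h.toInv
  primAt := h.primAt
  fresh t ht hmem := by
    obtain ⟨i, hi⟩ := h.has_zero t ht
    exact (hL _ hmem).2 i hi
  candidates := hL
  complete u hd hu hq := by
    obtain ⟨l, hl, hz, ha⟩ := exists_aligned_of_isQIntegerLinear h.primAt hd hu hq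
    obtain ⟨m, hm, m', hm', hne⟩ := exists_ne_mem_support hu fun i hi =>
      not_X_dvd_of_forall_primAt h.primAt i (hi.trans hd)
    exact ⟨l, hall l hl hz fun v hv =>
      exists_mem_support_sideHom_eq (hz _) hd ha hm hm' hne hv, ha⟩

lemma EdgeInv.good_select {p : MvPolynomial (Fin N) A} {q : MvPolynomial (Fin (n + 2)) A}
    {st : Stack A N (n + 2)} (hr : GoodReturn p q st) {d : Decomp A (n + 2)}
    {f : MvPolynomial (Fin (n + 2)) A} (h : EdgeInv q d f) {Λ : Multiset (Fin (n + 2) → ℤ)}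
    (hΛ : IsEdgeDirections f Λ) : Good p ⟨.select Λ d f, st⟩ := by
  classical
  have hf0 := h.prim.ne_zero
  refine Good.of_local (fun cfg hs => ?_) ?_ fun s' hs => ?_
  · cases hs with | inside h => exact ⟨_, h, rfl⟩
  · rcases le_or_gt (Multiset.card Λ) 1 with hc | hc
    · exact ⟨_, .selectAll hc⟩
    · obtain ⟨v, hv⟩ := MvPolynomial.support_nonempty.2 hf0
      -- Intersecting with `Λ.toFinset` only makes the set finite: multiplicity two already implies
      -- membership.
      refine ⟨_, .selectMultiple (L := Λ.toFinset.filter fun l =>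
        2 ≤ Λ.count l ∧ l ∈ supportDirections f v) hc hv fun l => ?_⟩
      rw [Finset.mem_filter, Multiset.mem_toFinset]
      refine ⟨And.right, fun hl => ⟨?_, hl⟩⟩
      rw [← Multiset.count_pos]
      omega
  · cases hs with
    | selectAll hc =>
      refine (h.typeInv (fun l hl => ?_) fun l hl hz hm => ?_).good hr
      · exact hΛ.of_mem (Multiset.mem_toFinset.1 hl)
      · exact Multiset.mem_toFinset.2 (hΛ.mem_of_linesMeetTwice hm hl hz hf0)
    | selectMultiple hc hv hL =>
      refine (h.typeInv (fun l hl => ?_) fun l hl hz hm => ?_).good hr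
      · refine hΛ.of_mem (Multiset.count_pos.1 ?_)
        have := ((hL l).1 hl).1
        omega
      · exact (hL l).2 ⟨hΛ.two_le_count hm hl hz hf0 hc, hm.mem_supportDirections hl hz hv⟩

lemma EdgeInv.good {p : MvPolynomial (Fin N) A} {q : MvPolynomial (Fin (n + 2)) A}
    {st : Stack A N (n + 2)} (hr : GoodReturn p q st) {d : Decomp A (n + 2)}
    {f : MvPolynomial (Fin (n + 2)) A} (h : EdgeInv q d f) : Good p ⟨.edges d f, st⟩ := by
  refine Good.of_local (fun cfg hs => ?_) ?_ fun s' hs => ?_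
  · cases hs with | inside h => exact ⟨_, h, rfl⟩
  · rcases Nat.eq_zero_or_pos f.totalDegree with h0 | h0
    · exact ⟨_, .constantRest h0⟩
    · obtain ⟨Λ, hΛ⟩ := exists_isEdgeDirections f
      exact ⟨_, .edgeDirections h0 hΛ⟩
  · cases hs with
    | constantRest hf => exact hr _ (h.isQILD_of_constant hf)
    | edgeDirections hf hΛ => exact h.good_select hr hΛ

/-- The invariant of the loop over the variables. -/
structure VarInv (q : MvPolynomial (Fin (n + 2)) A) (k : ℕ) (d : Decomp A (n + 2))
    (f : MvPolynomial (Fin (n + 2)) A) : Prop extends Inv q d f where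
  primAt : ∀ i : Fin (n + 2), i.val < k → PrimAt i f
  has_zero : ∀ t ∈ d.factors, ∃ i : Fin (n + 2), i.val < k ∧ t.1 i = 0

lemma VarInv.noContent {q : MvPolynomial (Fin (n + 2)) A} {k : ℕ} {d : Decomp A (n + 2)}
    {f : MvPolynomial (Fin (n + 2)) A} (h : VarInv q k d f) (hk : k < n + 2)
    (hg : IsContentAt ⟨k, hk⟩ f 1) : VarInv q (k + 1) d f where
  toInv := h.toInv
  primAt i hi := by
    rcases (Nat.lt_succ_iff.1 hi).lt_or_eq with hi | hi
    · exact h.primAt i hi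
    · obtain rfl : i = ⟨k, hk⟩ := Fin.ext hi
      exact hg.primAt (f' := f) (by rw [map_one, one_mul]) h.prim.ne_zero
  has_zero t ht := by
    obtain ⟨i, hi, hz⟩ := h.has_zero t ht
    exact ⟨i, by omega, hz⟩

/-- Old types vanish at some coordinate before `k`, whereas new ones vanish at no such coordinate,
since `f` has no nonunit factor missing an earlier variable. -/
lemma VarInv.merge {q : MvPolynomial (Fin (n + 2)) A} {k : ℕ} {d : Decomp A (n + 2)}
    {f f' : MvPolynomial (Fin (n + 2)) A} {g : MvPolynomial (Fin (n + 1)) A}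
    {e : Decomp A (n + 1)} (h : VarInv q k d f) (hk : k < n + 2)
    (hg : IsContentAt ⟨k, hk⟩ f g) (hf : f = embedAt ⟨k, hk⟩ g * f') (he : IsQILD g e) :
    VarInv q (k + 1) (d.merge ⟨k, hk⟩ e) f' := by
  have hd' : f' ∣ f := ⟨embedAt ⟨k, hk⟩ g, hf.trans (mul_comm _ _)⟩
  have htypes : ∀ t ∈ e.factors, ∀ j : Fin (n + 2), j.val < k → insertZero ⟨k, hk⟩ t.1 j ≠ 0 :=
    fun t ht j hj => he.type_ne_zero (by rintro rfl; exact hj.ne rfl) hg.dvd (h.primAt j hj) ht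
  refine ⟨⟨?_, h.valid.merge (isQILD_iff.1 he).2 _ ?_, h.prim.of_dvd hd'⟩, ?_, ?_⟩
  · rw [embedLaurent_value, h.value, hf, map_mul, ← embedLaurent_toLaurent, he.eq_value]
    ring
  · intro t ht t' ht' e'
    obtain ⟨i, hi, hz⟩ := h.has_zero t ht
    exact htypes t' ht' i hi (e' ▸ hz)
  · intro i hi
    rcases (Nat.lt_succ_iff.1 hi).lt_or_eq with hi | hi
    · exact (h.primAt i hi).of_dvd hd'
    · obtain rfl : i = ⟨k, hk⟩ := Fin.ext hi
      exact hg.primAt hf h.prim.ne_zero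
  · intro t ht
    rcases List.mem_append.1 ht with ht | ht
    · obtain ⟨i, hi, hz⟩ := h.has_zero t ht
      exact ⟨i, by omega, hz⟩
    · obtain ⟨t', -, rfl⟩ := List.mem_map.1 ht
      exact ⟨⟨k, hk⟩, by simp, by simp⟩

lemma VarInv.good {p : MvPolynomial (Fin N) A} {q : MvPolynomial (Fin (n + 2)) A}
    {st : Stack A N (n + 2)} (hr : GoodReturn p q st)
    (hrec : ∀ (g : MvPolynomial (Fin (n + 1)) A) (st' : Stack A N (n + 1)),
      GoodReturn p g st' → Good p ⟨.start g, st'⟩)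
    {k : ℕ} {d : Decomp A (n + 2)} {f : MvPolynomial (Fin (n + 2)) A} (h : VarInv q k d f) :
    Good p ⟨.varLoop k d f, st⟩ := by
  induction hK : n + 2 - k generalizing k d f with
  | zero =>
    refine Good.of_local (fun cfg hs => ?_) ⟨_, .varsDone (by omega)⟩ fun s' hs => ?_
    · cases hs with
      | inside h => exact ⟨_, h, rfl⟩
      | call hk => omega
    · cases hs with
      | noContent hk => omega
      | varsDone hk =>
        refine EdgeInv.good hr ⟨h.toInv, fun i => h.primAt i (by omega), fun t ht => ?_⟩
        obtain ⟨i, -, hz⟩ := h.has_zero t ht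
        exact ⟨i, hz⟩
  | succ r ih =>
    have hk : k < n + 2 := by omega
    refine ⟨_, fun cfg hs => ?_, fun hstuck => ?_⟩
    · cases hs with
      | inside hs =>
        cases hs with
        | noContent hk hg => exact ih (h.noContent hk hg) (by omega)
        | varsDone hk => omega
      | call hk hg hf h1 =>
        -- The return condition of the call is the claim for the next loop index, with the merged
        -- data.
        refine hrec _ _ fun e he => ⟨_, fun cfg hs => ?_, fun hstuck => absurd .ret (hstuck _)⟩
        cases hs with
        | inside hs => cases hs
        | ret => exact ih (h.merge hk hg hf he) (by simp; omega)
    · exfalso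
      obtain ⟨g, hg⟩ := exists_isContentAt ⟨k, hk⟩ f
      -- A unit content other than `1` also leads to a recursive call, which is covered by the same
      -- argument.
      by_cases h1 : g = 1
      · subst h1
        exact hstuck _ (.inside (.noContent hk hg))
      · obtain ⟨f', hf'⟩ := hg.dvd
        exact hstuck _ (.call hk hg hf' h1)

/-- A polynomial in one variable that is primitive and not a monomial. -/
lemma isQILD_univariate {q f : MvPolynomial (Fin 1) A} {c : A} {a : ℕ} {P : Polynomial A}
    (hq : q = MvPolynomial.C c * f) (hf : PrimC f) (hs : ∀ m, f.support ≠ {m})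
    (ha : IsLeast {k | ∃ m ∈ f.support, m 0 = k} a)
    (hP : f = MvPolynomial.X 0 ^ a * Polynomial.aeval (MvPolynomial.X 0) P) :
    IsQILD q ⟨c, fun _ => a, 1, [(fun _ => 1, P)]⟩ := by
  have hX : toLaurent (MvPolynomial.X 0 : MvPolynomial (Fin 1) A) = mono A (fun _ => 1) := by
    rw [toLaurent, MvPolynomial.aeval_X]
    congr 1
    ext i
    rw [Subsingleton.elim i 0]; simp
  have hXa : toLaurent (MvPolynomial.X 0 ^ a : MvPolynomial (Fin 1) A) =
      mono A (fun _ => (a : ℤ)) := by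
    rw [map_pow, hX, mono_pow]
    congr 1
    ext i; simp
  have hnorm : IsNormalizedVec (fun _ : Fin 1 => (1 : ℤ)) :=
    ⟨by simp, 0, by simp, fun j hj => absurd hj (by simp [Subsingleton.elim j 0])⟩
  -- Otherwise `x^(a+1)` divides `f`, although `a` occurs as an exponent.
  have hP0 : P.coeff 0 ≠ 0 := by
    intro h0
    obtain ⟨P', rfl⟩ := Polynomial.X_dvd_iff.2 h0
    obtain ⟨m, hm, hma⟩ := ha.1
    have hd : (MvPolynomial.X 0 ^ (a + 1) : MvPolynomial (Fin 1) A) ∣ f := by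
      rw [hP, map_mul, Polynomial.aeval_X, ← mul_assoc, ← pow_succ]
      exact Dvd.intro _ rfl
    obtain ⟨w, hw⟩ := hd
    rw [MvPolynomial.X_pow_eq_monomial] at hw
    rw [MvPolynomial.mem_support_iff, hw, MvPolynomial.coeff_monomial_mul', if_neg] at hm
    · exact hm rfl
    · intro hle
      have := hle 0
      simp at this
      omega
  -- A constant `P` would make `f` a monomial, a case already returned.
  have hdeg : 0 < P.natDegree := by
    rw [Nat.pos_iff_ne_zero]
    intro h0
    obtain ⟨r, rfl⟩ := Polynomial.natDegree_eq_zero.1 h0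
    classical
    refine hs (Finsupp.single 0 a) ?_
    rw [hP, Polynomial.aeval_C, MvPolynomial.algebraMap_eq, mul_comm,
      MvPolynomial.X_pow_eq_monomial, MvPolynomial.C_mul_monomial, mul_one, MvPolynomial.support_monomial, if_neg]
    simpa using hP0
  rw [isQILD_iff]
  refine ⟨?_, ?_, ?_, ?_, ?_, ?_⟩
  · rw [hq, hP, map_mul, map_mul, toLaurent_C, hXa, ← Polynomial.aeval_algHom_apply, hX]
    simp [Decomp.value, substMono]
  · exact isPrimitive_iff_primC.2 PrimC.one
  · exact fun h hi hd => absurd (isUnit_of_dvd_one hd) hi.not_isUnit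
  · simp only [List.mem_singleton, forall_eq]
    refine ⟨⟨fun r hr => hf r ?_, hP0⟩, hdeg⟩
    rw [hP]
    refine Dvd.dvd.mul_left ?_ _
    have := map_dvd (Polynomial.aeval (MvPolynomial.X 0 : MvPolynomial (Fin 1) A)) hr
    rwa [Polynomial.aeval_C] at this
  · simpa using hnorm
  · simp

/-- A polynomial in one variable is a power of the variable times a univariate polynomial. -/
lemma exists_eq_X_pow_mul_aeval {f : MvPolynomial (Fin 1) A} (hf : f ≠ 0) :
    ∃ (a : ℕ) (P : Polynomial A), IsLeast {k | ∃ m ∈ f.support, m 0 = k} a ∧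
      f = MvPolynomial.X 0 ^ a * Polynomial.aeval (MvPolynomial.X 0) P := by
  obtain ⟨m, hm, hmin⟩ := Finset.exists_min_image f.support (fun m => m 0)
    (MvPolynomial.support_nonempty.2 hf)
  refine ⟨m 0, ∑ w ∈ f.support, Polynomial.monomial (w 0 - m 0) (f.coeff w),
    ⟨⟨m, hm, rfl⟩, ?_⟩, ?_⟩
  · rintro _ ⟨w, hw, rfl⟩
    exact hmin w hw
  · conv_lhs => rw [f.as_sum]
    rw [map_sum, Finset.mul_sum]
    refine Finset.sum_congr rfl fun w hw => ?_
    have hw0 : Finsupp.single 0 (w 0) = w := by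
      ext; simp
    rw [Polynomial.aeval_monomial, mul_left_comm, ← pow_add, Nat.add_sub_cancel' (hmin w hw),
      MvPolynomial.algebraMap_eq, MvPolynomial.X_pow_eq_monomial, MvPolynomial.C_mul_monomial,
      mul_one, hw0]

lemma isQILD_constant (a : A) :
    IsQILD (MvPolynomial.C a : MvPolynomial (Fin n) A) ⟨a, 0, 1, []⟩ := by
  rw [isQILD_iff]
  refine ⟨?_, Decomp.valid_of_one _ _⟩
  rw [toLaurent_C]
  simp only [Decomp.value, map_one, List.map_nil, List.prod_nil, mul_one]
  congr 1

lemma isQILD_monomial {q f : MvPolynomial (Fin n) A} {c : A} {m : Fin n →₀ ℕ}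
    (hq : q = MvPolynomial.C c * f) (hm : f.support = {m}) :
    IsQILD q ⟨c * f.coeff m, m, 1, []⟩ := by
  rw [isQILD_iff]
  refine ⟨?_, Decomp.valid_of_one _ _⟩
  rw [hq, map_mul, toLaurent_C, toLaurent_eq_sum, hm, Finset.sum_singleton]
  simp only [Decomp.value, map_one, List.map_nil, List.prod_nil, mul_one, smul_one_mul, mul_smul]
  rfl

/-- Induction on the number of variables, for all inputs and stacks at once, as a recursive call has
one variable less and a longer stack. -/
lemma good_start {p : MvPolynomial (Fin N) A} : ∀ {n : ℕ} (q : MvPolynomial (Fin n) A)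
    (st : Stack A N n), GoodReturn p q st → Good p ⟨.start q, st⟩ := by
  intro n
  induction n with
  | zero =>
    intro q st hr
    have hq := MvPolynomial.eq_C_of_isEmpty q
    refine Good.of_local (fun cfg hs => ?_) ⟨_, .constant hq⟩ fun s' hs => ?_
    · cases hs with | inside h => exact ⟨_, h, rfl⟩
    · cases hs with
      | constant h => subst h; exact hr _ (isQILD_constant _)
      | monomial hp => exact absurd hq (hp _)
      | content hp => exact absurd hq (hp _)
  | succ n ih =>
    intro q st hr
    refine Good.of_local (fun cfg hs => ?_) ?_ fun s' hs => ?_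
    · cases hs with | inside h => exact ⟨_, h, rfl⟩
    · by_cases hp : ∃ r, q = MvPolynomial.C r
      · obtain ⟨r, hr⟩ := hp
        exact ⟨_, .constant hr⟩
      · push Not at hp
        obtain ⟨c, hc⟩ := exists_isContent q
        obtain ⟨f, hf⟩ := hc.exists_eq_mul
        by_cases ha : ∃ a, f.support = {a}
        · obtain ⟨a, ha⟩ := ha
          exact ⟨_, .monomial hp hc hf ha⟩
        · push Not at ha
          exact ⟨_, .content hp hc hf ha⟩
    · cases hs with
      | constant h => subst h; exact hr _ (isQILD_constant _)
      | monomial hp hc hf ha => exact hr _ (isQILD_monomial hf ha)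
      | content hp hc hf ha =>
        -- The zero polynomial is constant, so it never reaches this branch.
        have hprim := hc.primC hf (by rintro rfl; exact hp 0 MvPolynomial.C_0.symm)
        refine Good.of_local (fun cfg hs => ?_) ?_ fun s' hs => ?_
        · cases hs with | inside h => exact ⟨_, h, rfl⟩
        · cases n with
          | zero =>
            obtain ⟨a, P, h1, h2⟩ := exists_eq_X_pow_mul_aeval hprim.ne_zero
            exact ⟨_, .univariate h1 h2⟩
          | succ n => exact ⟨_, .multivariate (by omega)⟩
        · cases hs with
          | univariate h1 h2 => exact hr _ (isQILD_univariate hf hprim ha h1 h2)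
          | multivariate hn =>
            obtain ⟨n, rfl⟩ := Nat.exists_eq_succ_of_ne_zero (fun h => hn (by rw [h]) : n ≠ 0)
            refine VarInv.good hr ih ⟨⟨?_, Decomp.valid_of_one _ _, hprim⟩, by simp, by simp⟩
            rw [hf, map_mul, toLaurent_C]
            simp only [Decomp.value, map_one, List.map_nil, List.prod_nil, mul_one]
            congr 1

end Invocation

end

end QILD

theorem theorem3p9 {D : Type*} [CommRing D] [IsDomain D] [UniqueFactorizationMonoid D] [CharZero D]
    (n : ℕ) (p : MvPolynomial (Fin n) (LaurentPolynomial D)) :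
    (¬ ∃ run : ℕ → QILD.Config (LaurentPolynomial D) n,
        run 0 = QILD.initial p ∧ ∀ k, QILD.Step (run k) (run (k + 1))) ∧
    (∀ cfg : QILD.Config (LaurentPolynomial D) n,
        Relation.ReflTransGen QILD.Step (QILD.initial p) cfg →
        (∀ cfg', ¬ QILD.Step cfg cfg') →
        ∃ d : QILD.Decomp (LaurentPolynomial D) n, cfg = QILD.final d ∧ QILD.IsQILD p d) := by
  -- `D[q, q⁻¹]` is the localization of the factorial ring `D[X]` at the powers of `X`.
  have : UniqueFactorizationMonoid (LaurentPolynomial D) :=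
    UniqueFactorizationMonoid.of_isLocalization (Submonoid.powers (Polynomial.X : Polynomial D)) _
  have hgood : QILD.Good p (QILD.initial p) := QILD.good_start p _ (QILD.goodReturn_nil p)
  refine ⟨hgood.no_infinite_run, fun cfg hr hstuck => ?_⟩
  cases hgood.of_reachable hr with
  | intro _ _ h => exact h hstuck
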